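/- Let $N\ge 1$ be an integer. On real projective space $\mathbb{P}^N(\mathbb{R})$ use the metric $$\delta_\infty(\hat{\mathbf x},\hat{\mathbf y})=\frac{|\mathbf x\wedge\mathbf y|}{|\mathbf x|\,|\mathbf y|},$$ where $\mathbf x,\mathbf y\in\mathbb{R}^{N+1}\setminus\{\mathbf 0\}$ are any homogeneous coordinates of $\hat{\mathbf x},\hat{\mathbf y}$ and $|\cdot|$ is the Euclidean norm; that is, $\delta_\infty$ is the sine of the angle between the two lines. For $\hat{\mathbf q}\in\mathbb{P}^N(\mathbb{Q})$ let $H(\hat{\mathbf q})=\max_i|q_i|$, where $q_0,\dots,q_N$ are homogeneous coordinates of $\hat{\mathbf q}$ that are integers with $\gcd(q_0,\dots,q_N)=1$. Put $$\mathbf{Bad}_{\mathbb P}^\infty(N)=\Big\{\hat{\mathbf x}\in\mathbb{P}^N(\mathbb{R}):\ \inf_{\hat{\mathbf q}\in\mathbb{P}^N(\mathbb{Q})}H(\hat{\mathbf q})^{\frac{N+1}{N}}\,\delta_\infty(\hat{\mathbf x},\hat{\mathbf q})>0\Big\}.$$ Let $\phi:\mathbb{R}^{N+1}\setminus\{\mathbf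 0\}\to\mathbb{P}^N(\mathbb{R})$ be the quotient map, let $\lambda$ be Lebesgue measure on $\mathbb{R}^{N+1}$, let $B$ be the closed Euclidean unit ball, and let $\hat\mu_\infty(M)=\lambda(\phi^{-1}(M)\cap B)/\lambda(B)$ for every $M\subseteq\mathbb{P}^N(\mathbb{R})$ such that $\phi^{-1}(M)$ is Borel. Write $\hat B(\hat{\mathbf x},r)$ for the closed $\delta_\infty$-ball of centre $\hat{\mathbf x}$ and radius $r$. **Theorem.** For every integer $N\ge1$: 1. The set $\mathbf{Bad}_{\mathbb P}^\infty(N)$ has full Hausdorff dimension: $\dim_H\mathbf{Bad}_{\mathbb P}^\infty(N)=N$, where $\dim_H$ is taken with respect to $\delta_\infty$. 2. The measure $\hat\mu_\infty$ is $N$-Ahlfors regular: there are constants $r_0>0$ and $0<a\le1\le b$ such that $a r^N\le\hat\mu_\infty(\hat B(\hat{\mathbf x},r))\le b r^N$ for all $\hat{\mathbf x}\in\mathbb{P}^N(\mathbb{R})$ and all $0<r<r_0$. 3. The measure $\hat\mu_\infty$ is projectively absolutely decaying: there are constants $c,\eta,r_0>0$ such that $$\hat\mu_\infty\big(\hat B(\hat{\mathbf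 x},r)\cap\mathcal P^{(\epsilon)}\big)\le c\Big(\frac{\epsilon}{r}\Big)^{\eta}\hat\mu_\infty\big(\hat B(\hat{\mathbf x},r)\big)$$ for every projective hyperplane $\mathcal P=\phi(\mathcal L\setminus\{\mathbf 0\})$ ($\mathcal L$ an $N$-dimensional linear subspace of $\mathbb{R}^{N+1}$), every $\epsilon>0$, every $\hat{\mathbf x}\in\mathbb{P}^N(\mathbb{R})$ and every $0<r<r_0$, where $\mathcal P^{(\epsilon)}$ is the set of points at $\delta_\infty$-distance less than $\epsilon$ from $\mathcal P$. -/

import Mathlib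

namespace ProjBad

open MeasureTheory

/-- The real vector space `ℝ^(N+1)` with its Euclidean norm and Lebesgue measure. -/
abbrev Vec (N : ℕ) : Type := EuclideanSpace ℝ (Fin (N + 1))

/-- Real projective space `ℙ^N(ℝ)`. -/
abbrev RealProj (N : ℕ) : Type := Projectivization ℝ (Vec N)

/-- Rational projective space `ℙ^N(ℚ)`. -/
abbrev RatProj (N : ℕ) : Type := Projectivization ℚ (Fin (N + 1) → ℚ)

/-- The Euclidean norm of the bivector `x ∧ y`, in the coordinates `x_i y_j - x_j y_i`, `i < j`. -/
noncomputable def wedgeNorm {N : ℕ} (x y : Vec N) : ℝ :=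
  Real.sqrt (∑ i, ∑ j, if i < j then (x i * y j - x j * y i) ^ 2 else 0)

/-- The projective metric `‖x ∧ y‖ / (‖x‖ ‖y‖)`; see `delta_mk_mk` for the independence of the
representatives. -/
noncomputable def delta {N : ℕ} (p q : RealProj N) : ℝ :=
  wedgeNorm p.rep q.rep / (‖p.rep‖ * ‖q.rep‖)

theorem wedgeNorm_sq_sum {N : ℕ} (x y : Vec N) :
    (∑ i, ∑ j, if i < j then (x i * y j - x j * y i) ^ 2 else 0)
      = ‖x‖ ^ 2 * ‖y‖ ^ 2 - (inner ℝ x y) ^ 2 := by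
  set A : ℝ := ∑ i, ∑ j, if i < j then (x i * y j - x j * y i) ^ 2 else 0 with hA
  have hA' : A = ∑ i, ∑ j, if j < i then (x i * y j - x j * y i) ^ 2 else 0 := by
    rw [hA, Finset.sum_comm]
    refine Finset.sum_congr rfl fun i _ => Finset.sum_congr rfl fun j _ => ?_
    split_ifs
    · ring
    · rfl
  have h2 : A + A = ∑ i, ∑ j, (x i * y j - x j * y i) ^ 2 := by
    nth_rewrite 2 [hA']
    rw [hA, ← Finset.sum_add_distrib]
    refine Finset.sum_congr rfl fun i _ => ?_
    rw [← Finset.sum_add_distrib]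
    refine Finset.sum_congr rfl fun j _ => ?_
    rcases lt_trichotomy i j with h | h | h
    · simp [h, h.not_gt]
    · subst h
      simp
    · simp [h, h.not_gt]
  have h3 : (∑ i, ∑ j, (x i * y j - x j * y i) ^ 2)
      = 2 * ((∑ i, x i ^ 2) * (∑ j, y j ^ 2) - (∑ i, x i * y i) ^ 2) := by
    have e1 : (∑ i, x i ^ 2) * (∑ j, y j ^ 2) = ∑ i, ∑ j, x i ^ 2 * y j ^ 2 :=
      Finset.sum_mul_sum _ _ _ _
    have e1' : (∑ i, x i ^ 2) * (∑ j, y j ^ 2) = ∑ i, ∑ j, x j ^ 2 * y i ^ 2 := by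
      rw [e1, Finset.sum_comm]
    have e2 : (∑ i, x i * y i) ^ 2 = ∑ i, ∑ j, (x i * y i) * (x j * y j) := by
      rw [sq, Finset.sum_mul_sum]
    have e3 : (∑ i, ∑ j, (x i * y j - x j * y i) ^ 2)
        = (∑ i, ∑ j, x i ^ 2 * y j ^ 2) + (∑ i, ∑ j, x j ^ 2 * y i ^ 2)
          - 2 * ∑ i, ∑ j, (x i * y i) * (x j * y j) := by
      simp only [Finset.mul_sum, ← Finset.sum_add_distrib, ← Finset.sum_sub_distrib]
      refine Finset.sum_congr rfl fun i _ => Finset.sum_congr rfl fun j _ => ?_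
      ring
    rw [e3, ← e1, ← e1', ← e2]
    ring
  have h4 : inner ℝ x y = ∑ i, x i * y i := by
    rw [PiLp.inner_apply]
    refine Finset.sum_congr rfl fun i _ => ?_
    simp [mul_comm]
  rw [EuclideanSpace.real_norm_sq_eq, EuclideanSpace.real_norm_sq_eq, h4]
  linarith

theorem wedgeNorm_eq {N : ℕ} (x y : Vec N) :
    wedgeNorm x y = Real.sqrt (‖x‖ ^ 2 * ‖y‖ ^ 2 - (inner ℝ x y) ^ 2) := by
  rw [wedgeNorm, wedgeNorm_sq_sum]

theorem wedgeNorm_comm {N : ℕ} (x y : Vec N) : wedgeNorm x y = wedgeNorm y x := by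
  rw [wedgeNorm_eq, wedgeNorm_eq, real_inner_comm, mul_comm]

theorem wedgeNorm_smul {N : ℕ} (a b : ℝ) (x y : Vec N) :
    wedgeNorm (a • x) (b • y) = |a| * |b| * wedgeNorm x y := by
  rw [wedgeNorm_eq, wedgeNorm_eq, norm_smul, norm_smul, inner_smul_left, inner_smul_right]
  have : (‖a‖ * ‖x‖) ^ 2 * (‖b‖ * ‖y‖) ^ 2 - ((starRingEnd ℝ) a * (b * inner ℝ x y)) ^ 2
      = (|a| * |b|) ^ 2 * (‖x‖ ^ 2 * ‖y‖ ^ 2 - (inner ℝ x y) ^ 2) := by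
    simp only [Real.norm_eq_abs, conj_trivial, mul_pow, sq_abs]
    ring
  rw [this, Real.sqrt_mul (sq_nonneg _), Real.sqrt_sq (by positivity)]

/-- The metric may be computed from arbitrary homogeneous coordinates. -/
theorem delta_mk_mk {N : ℕ} (x y : Vec N) (hx : x ≠ 0) (hy : y ≠ 0) :
    delta (Projectivization.mk ℝ x hx) (Projectivization.mk ℝ y hy)
      = wedgeNorm x y / (‖x‖ * ‖y‖) := by
  obtain ⟨a, ha⟩ := Projectivization.exists_smul_eq_mk_rep ℝ x hx
  obtain ⟨b, hb⟩ := Projectivization.exists_smul_eq_mk_rep ℝ y hy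
  have ha0 : |(a : ℝ)| ≠ 0 := abs_ne_zero.2 a.ne_zero
  have hb0 : |(b : ℝ)| ≠ 0 := abs_ne_zero.2 b.ne_zero
  rw [delta, ← ha, ← hb, Units.smul_def, Units.smul_def, wedgeNorm_smul, norm_smul, norm_smul,
    Real.norm_eq_abs, Real.norm_eq_abs]
  rw [show |(a : ℝ)| * ‖x‖ * (|(b : ℝ)| * ‖y‖) = (|(a : ℝ)| * |(b : ℝ)|) * (‖x‖ * ‖y‖) by ring]
  exact mul_div_mul_left _ _ (mul_ne_zero ha0 hb0)

theorem exists_unit_rep {N : ℕ} (p : RealProj N) :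
    ∃ (x : Vec N) (hx : x ≠ 0), ‖x‖ = 1 ∧ p = Projectivization.mk ℝ x hx := by
  induction p using Projectivization.ind with
  | h v hv =>
    have hn : ‖v‖ ≠ 0 := norm_ne_zero_iff.2 hv
    have hw : ‖v‖⁻¹ • v ≠ 0 := smul_ne_zero (inv_ne_zero hn) hv
    refine ⟨‖v‖⁻¹ • v, hw, ?_, ?_⟩
    · rw [norm_smul, norm_inv, norm_norm, inv_mul_cancel₀ hn]
    · rw [Projectivization.mk_eq_mk_iff']
      exact ⟨‖v‖, smul_inv_smul₀ hn v⟩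

theorem norm_sub_smul_sq {N : ℕ} {x y : Vec N} (hx : ‖x‖ = 1) (hy : ‖y‖ = 1) (c : ℝ) :
    ‖x - c • y‖ ^ 2 = 1 - (inner ℝ x y) ^ 2 + (c - inner ℝ x y) ^ 2 := by
  rw [norm_sub_sq_real, norm_smul, inner_smul_right, hx, hy, Real.norm_eq_abs, mul_one, sq_abs]
  ring

theorem wedgeNorm_eq_norm {N : ℕ} {x y : Vec N} (hx : ‖x‖ = 1) (hy : ‖y‖ = 1) :
    wedgeNorm x y = ‖x - (inner ℝ x y : ℝ) • y‖ := by
  rw [wedgeNorm_eq, ← Real.sqrt_sq (norm_nonneg (x - (inner ℝ x y : ℝ) • y)),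
    norm_sub_smul_sq hx hy, hx, hy]
  congr 1
  ring

theorem wedgeNorm_le_norm {N : ℕ} {x y : Vec N} (hx : ‖x‖ = 1) (hy : ‖y‖ = 1) (c : ℝ) :
    wedgeNorm x y ≤ ‖x - c • y‖ := by
  rw [wedgeNorm_eq_norm hx hy]
  refine le_of_sq_le_sq ?_ (norm_nonneg _)
  rw [norm_sub_smul_sq hx hy, norm_sub_smul_sq hx hy]
  nlinarith [sq_nonneg (c - inner ℝ x y)]

theorem wedgeNorm_triangle {N : ℕ} {x y z : Vec N} (hx : ‖x‖ = 1) (hy : ‖y‖ = 1) (hz : ‖z‖ = 1) :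
    wedgeNorm x z ≤ wedgeNorm x y + wedgeNorm y z := by
  set s : ℝ := inner ℝ x y with hs
  set t : ℝ := inner ℝ y z with ht
  have hs1 : |s| ≤ 1 := by
    have := abs_real_inner_le_norm x y
    rwa [hx, hy, mul_one] at this
  have hsplit : x - (s * t) • z = (x - s • y) + s • (y - t • z) := by
    rw [smul_sub, smul_smul]
    abel
  calc wedgeNorm x z ≤ ‖x - (s * t) • z‖ := wedgeNorm_le_norm hx hz _
    _ ≤ ‖x - s • y‖ + ‖s • (y - t • z)‖ := by rw [hsplit]; exact norm_add_le _ _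
    _ ≤ ‖x - s • y‖ + ‖y - t • z‖ := by
        rw [norm_smul, Real.norm_eq_abs]
        have := mul_le_mul_of_nonneg_right hs1 (norm_nonneg (y - t • z))
        linarith
    _ = wedgeNorm x y + wedgeNorm y z := by
        rw [wedgeNorm_eq_norm hx hy, wedgeNorm_eq_norm hy hz]

noncomputable instance instMetricSpaceRealProj (N : ℕ) : MetricSpace (RealProj N) where
  dist := delta
  dist_self p := by
    obtain ⟨x, hx0, hx, rfl⟩ := exists_unit_rep p
    rw [delta_mk_mk, wedgeNorm_eq, real_inner_self_eq_norm_sq]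
    simp [hx]
  dist_comm p q := by
    rw [delta, delta, wedgeNorm_comm, mul_comm ‖p.rep‖]
  dist_triangle p q r := by
    obtain ⟨x, hx0, hx, rfl⟩ := exists_unit_rep p
    obtain ⟨y, hy0, hy, rfl⟩ := exists_unit_rep q
    obtain ⟨z, hz0, hz, rfl⟩ := exists_unit_rep r
    simp only [delta_mk_mk, hx, hy, hz, mul_one, div_one]
    exact wedgeNorm_triangle hx hy hz
  eq_of_dist_eq_zero {p q} h := by
    change delta p q = 0 at h
    obtain ⟨x, hx0, hx, rfl⟩ := exists_unit_rep p
    obtain ⟨y, hy0, hy, rfl⟩ := exists_unit_rep q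
    rw [delta_mk_mk, hx, hy, mul_one, div_one, wedgeNorm_eq_norm hx hy, norm_eq_zero,
      sub_eq_zero] at h
    rw [Projectivization.mk_eq_mk_iff']
    exact ⟨inner ℝ x y, h.symm⟩

/-- The coordinatewise inclusion `ℚ^(N+1) → ℝ^(N+1)`. -/
noncomputable def ratVec (N : ℕ) : (Fin (N + 1) → ℚ) →ₛₗ[Rat.castHom ℝ] Vec N where
  toFun v := WithLp.toLp 2 fun i => (v i : ℝ)
  map_add' v w := by
    ext i
    simp
  map_smul' c v := by
    ext i
    simp

theorem ratVec_injective (N : ℕ) : Function.Injective (ratVec N) := by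
  intro v w h
  funext i
  have := congrArg (fun u : Vec N => u i) h
  simpa [ratVec] using this

/-- The inclusion `ℙ^N(ℚ) → ℙ^N(ℝ)`. -/
noncomputable def ratPoint {N : ℕ} : RatProj N → RealProj N :=
  Projectivization.map (ratVec N) (ratVec_injective N)

/-- The height of `q ∈ ℙ^N(ℚ)`: the largest absolute value of a coordinate in homogeneous
coordinates that are coprime integers; see `height_mk`. -/
noncomputable def height {N : ℕ} (q : RatProj N) : ℝ := q.mulHeight

theorem height_mk {N : ℕ} (q : Fin (N + 1) → ℤ) (hq : Finset.univ.gcd q = 1)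
    (h0 : (fun i => (q i : ℚ)) ≠ 0) :
    height (Projectivization.mk ℚ (fun i => (q i : ℚ)) h0) = ((⨆ i, |q i| : ℤ) : ℝ) := by
  rw [height, Projectivization.mulHeight_mk]
  have := Rat.mulHeight_eq_max_abs_of_gcd_eq_one hq
  simpa [Function.comp_def] using this

/-- The badly approximable points of `ℙ^N(ℝ)`. -/
def Bad (N : ℕ) : Set (RealProj N) :=
  {x | 0 < ⨅ q : RatProj N, height q ^ (((N : ℝ) + 1) / N) * dist x (ratPoint q)}

/-- A set `M ⊆ ℙ^N(ℝ)` is measurable when the cone of nonzero vectors over it is Borel. -/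
noncomputable instance instMeasurableSpaceRealProj (N : ℕ) : MeasurableSpace (RealProj N) :=
  MeasurableSpace.map (Projectivization.mk' ℝ : {v : Vec N // v ≠ 0} → RealProj N) inferInstance

/-- The probability measure on `ℙ^N(ℝ)` giving `M` the proportion of the Euclidean unit ball
of `ℝ^(N+1)` that is occupied by the cone over `M`; see `projMeasure_apply`. -/
noncomputable def projMeasure (N : ℕ) : Measure (RealProj N) :=
  (volume (Metric.closedBall (0 : Vec N) 1))⁻¹ •
    Measure.map (Projectivization.mk' ℝ : {v : Vec N // v ≠ 0} → RealProj N)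
      (Measure.comap Subtype.val (volume.restrict (Metric.closedBall (0 : Vec N) 1)))

theorem projMeasure_apply {N : ℕ} {M : Set (RealProj N)} (hM : MeasurableSet M) :
    projMeasure N M =
      volume ({v : Vec N | ∃ hv : v ≠ 0, Projectivization.mk ℝ v hv ∈ M} ∩
        Metric.closedBall 0 1) / volume (Metric.closedBall (0 : Vec N) 1) := by
  have hφ : Measurable (Projectivization.mk' ℝ : {v : Vec N // v ≠ 0} → RealProj N) :=
    fun s hs => hs
  have hne : MeasurableSet {v : Vec N | v ≠ 0} := (measurableSet_singleton 0).compl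
  have hemb : MeasurableEmbedding (Subtype.val : {v : Vec N // v ≠ 0} → Vec N) :=
    MeasurableEmbedding.subtype_coe hne
  have himg : (Subtype.val '' ((Projectivization.mk' ℝ : {v : Vec N // v ≠ 0} → RealProj N) ⁻¹' M))
      = {v : Vec N | ∃ hv : v ≠ 0, Projectivization.mk ℝ v hv ∈ M} := by
    ext v
    simp
  have hmeas := hemb.measurableSet_image.2 (hφ hM)
  rw [himg] at hmeas
  rw [projMeasure, Measure.smul_apply, Measure.map_apply hφ hM, hemb.comap_apply, himg,
    Measure.restrict_apply hmeas, smul_eq_mul, mul_comm, div_eq_mul_inv]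

/-- A measure `m` carried by `Ω` is `δ`-Ahlfors regular on `Ω`. -/
def IsAhlforsRegular {N : ℕ} (m : Measure (RealProj N)) (Ω : Set (RealProj N)) (δ : ℝ) : Prop :=
  0 < δ ∧ ∃ r₀ a b : ℝ, 0 < r₀ ∧ 0 < a ∧ a ≤ 1 ∧ 1 ≤ b ∧
    ∀ x ∈ Ω, ∀ r : ℝ, 0 < r → r < r₀ →
      ENNReal.ofReal (a * r ^ δ) ≤ m (Metric.closedBall x r) ∧
        m (Metric.closedBall x r) ≤ ENNReal.ofReal (b * r ^ δ)

/-- Projective hyperplanes: the images of the linear hyperplanes of `ℝ^(N+1)`. -/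
def IsProjHyperplane {N : ℕ} (P : Set (RealProj N)) : Prop :=
  ∃ L : Submodule ℝ (Vec N), Module.finrank ℝ L = N ∧
    P = {p | ∃ (v : Vec N) (hv : v ≠ 0), v ∈ L ∧ Projectivization.mk ℝ v hv = p}

/-- A measure `m` carried by `Ω` is projectively absolutely decaying on `Ω`: neighbourhoods of
projective hyperplanes carry little of the mass of a ball centred in `Ω`. -/
def IsProjAbsDecaying {N : ℕ} (m : Measure (RealProj N)) (Ω : Set (RealProj N)) : Prop :=
  ∃ c η r₀ : ℝ, 0 < c ∧ 0 < η ∧ 0 < r₀ ∧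
    ∀ P : Set (RealProj N), IsProjHyperplane P →
      ∀ ε : ℝ, 0 < ε → ∀ x ∈ Ω, ∀ r : ℝ, 0 < r → r < r₀ →
        m (Metric.closedBall x r ∩ Metric.thickening ε P) ≤
          ENNReal.ofReal (c * (ε / r) ^ η) * m (Metric.closedBall x r)

end ProjBad

/-!
The upper bound `dimH (Bad N) ≤ N` holds because `ℙ^N(ℝ)` is covered by the Lipschitz images of
`N + 1` affine charts.

For the lower bound, a Cantor set of badly approximable points is built in the affine chart
`x ↦ [1 : x]`. By the simplex lemma (`exists_linear_form_of_small`), the rational points of small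
denominator near a ball of radius `ρ` all lie on one hyperplane. Of the `L ^ N` balls of radius
`ρ / (4L)` centred on a grid in that ball, at most `(N + 1) L ^ (N - 1)` come near the hyperplane;
the others keep a distance `ρ / (4L)` from those rational points (`exists_children`). Iterating
yields a Cantor set in which every point is badly approximable (`exists_badlyApproximable_coding`,
`chart_mem_Bad`). It has `m = L ^ N - (N + 1) L ^ (N - 1)` pieces at each step and contraction
ratio `1 / (4L)`, and its pieces are separated, so reading codes as base-`m` digits is a Hölder map
onto `[0, 1]` of exponent any `s` with `(4L) ^ s ≤ m` (`le_dimH_range_of_separated_coding`). As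
`L → ∞` every `s < N` is reached.

For the measure, an orthonormal basis whose first vector represents the centre of a ball turns the
cone over the ball of radius `r` into `|w'| ≤ r |w|`; its part in the unit ball lies between two
boxes of volume comparable to `r ^ N`, and this is Ahlfors regularity. A neighbourhood of a
hyperplane with unit normal `n` becomes `|⟨w, n⟩| ≤ ε |w|`. If `n` is close to the centre, this set
misses the ball; otherwise `n` has a transversal coordinate bounded below, and a linear change of
that coordinate shows that the slab cuts the box in volume at most a constant times `ε r ^ (N - 1)`
(`volume_slab_box_le`), giving decay with exponent `1`.
-/

/-! ### Hausdorff dimension of coded Cantor sets -/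

/-- A Cantor set coded by sequences of `m` symbols, in which points whose codes part at place `n`
are at distance at least `c θ⁻ⁿ`, has Hausdorff dimension at least `s` once `θ ^ s ≤ m`. Reading
codes as base-`m` expansions gives an `s`-Hölder map of the Cantor set onto `[0, 1]`, so no measure
has to be constructed. -/
theorem le_dimH_range_of_separated_coding {X : Type*} [MetricSpace X] {m : ℕ} (hm : 1 < m)
    {θ c : ℝ} (hθ : 0 < θ) (hc : 0 < c) {s : NNReal} (hs : 0 < s) (hsm : θ ^ (s : ℝ) ≤ m)
    (π : (ℕ → Fin m) → X)
    (hπ : ∀ a b n, (∀ i < n, a i = b i) → a n ≠ b n → c * θ⁻¹ ^ n ≤ dist (π a) (π b)) :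
    (s : ENNReal) ≤ dimH (Set.range π) := by
  classical
  have : NeZero m := ⟨by omega⟩
  have hdiff : ∀ a b : ℕ → Fin m, a ≠ b → ∃ n, (∀ i < n, a i = b i) ∧ a n ≠ b n := fun a b hab =>
    have hex := Function.ne_iff.1 hab
    ⟨Nat.find hex, fun i hi => not_not.1 (Nat.find_min hex hi), Nat.find_spec hex⟩
  have key : ∀ a b, |Real.ofDigits a - Real.ofDigits b| ≤ (c⁻¹ * dist (π a) (π b)) ^ (s : ℝ) := by
    intro a b
    by_cases hab : a = b
    · subst hab
      simp [hs.ne']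
    obtain ⟨n, hlt, hne⟩ := hdiff a b hab
    have h1 := hπ a b n hlt hne
    refine (Real.abs_ofDigits_sub_ofDigits_le hlt).trans ?_
    have h2 : θ⁻¹ ^ n ≤ c⁻¹ * dist (π a) (π b) := by
      rw [inv_mul_eq_div, le_div_iff₀ hc, mul_comm]
      exact h1
    calc ((m : ℝ) ^ n)⁻¹ ≤ ((θ ^ (s : ℝ)) ^ n)⁻¹ := by gcongr
      _ = (θ⁻¹ ^ n) ^ (s : ℝ) := by
        rw [← Real.rpow_natCast, ← Real.rpow_natCast, ← Real.rpow_mul hθ.le,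
          ← Real.rpow_mul (by positivity), Real.inv_rpow hθ.le, mul_comm]
      _ ≤ _ := by gcongr
  have hinj : Function.Injective π := by
    intro a b hab
    by_contra hab'
    obtain ⟨n, hlt, hne⟩ := hdiff a b hab'
    have h1 := hπ a b n hlt hne
    rw [hab, dist_self] at h1
    have : 0 < c * θ⁻¹ ^ n := by positivity
    linarith
  -- Reading the code of a point as base-`m` digits maps the image of `π` onto `[0, 1]`.
  set f : X → ℝ := fun x => Real.ofDigits (Function.invFun π x) with hf
  have hfπ : ∀ a, f (π a) = Real.ofDigits a := fun a => by
    simp only [hf, Function.leftInverse_invFun hinj a]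
  have hold : HolderOnWith (Real.toNNReal ((c⁻¹) ^ (s : ℝ))) s f (Set.range π) := by
    rintro _ ⟨a, rfl⟩ _ ⟨b, rfl⟩
    rw [hfπ, hfπ, edist_dist, edist_dist, Real.dist_eq]
    change _ ≤ ENNReal.ofReal _ * ENNReal.ofReal _ ^ (s : ℝ)
    rw [ENNReal.ofReal_rpow_of_nonneg dist_nonneg s.coe_nonneg]
    rw [← ENNReal.ofReal_mul (by positivity), ← Real.mul_rpow (by positivity) dist_nonneg]
    exact ENNReal.ofReal_le_ofReal (key a b)
  have himg : Set.Icc (0 : ℝ) 1 ⊆ f '' Set.range π := by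
    intro y hy
    obtain ⟨a, -, rfl⟩ := Real.ofDigits_SurjOn hm hy
    exact ⟨π a, ⟨a, rfl⟩, hfπ a⟩
  have h1 : (1 : ENNReal) ≤ dimH (f '' Set.range π) := by
    refine le_trans (le_of_eq ?_) (dimH_mono himg)
    rw [Real.dimH_of_nonempty_interior (by simp)]
    simp
  have h2 := h1.trans (hold.dimH_image_le hs)
  rwa [ENNReal.le_div_iff_mul_le (by simp [hs.ne']) (by simp), one_mul] at h2

/-! ### The simplex lemma -/

/-- A column operation subtracting `x i` times column `0` makes all columns but the first small,
and the Leibniz formula then bounds the determinant. -/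
theorem abs_det_le_of_close {N : ℕ} (x : Fin N → ℝ) {ρ : ℝ}
    (M : Matrix (Fin (N + 1)) (Fin (N + 1)) ℝ)
    (hM : ∀ k (i : Fin N), |M k i.succ - M k 0 * x i| ≤ ρ * |M k 0|) :
    |M.det| ≤ (∏ k, |M k 0|) * (ρ ^ N * (N + 1).factorial) := by
  set B : Matrix (Fin (N + 1)) (Fin (N + 1)) ℝ :=
    Matrix.of fun k j => M k j - (Fin.cons 0 x : Fin (N + 1) → ℝ) j * M k 0 with hB
  have hdet : M.det = B.det := by
    rw [← Matrix.det_transpose M, ← Matrix.det_transpose B]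
    refine Matrix.det_eq_of_forall_row_eq_smul_add_const (Fin.cons 0 x) 0 rfl fun j k => ?_
    simp [hB]
  rw [hdet, Matrix.det_apply']
  have hterm : ∀ σ : Equiv.Perm (Fin (N + 1)),
      |((Equiv.Perm.sign σ : ℤ) : ℝ) * ∏ i, B (σ i) i| ≤ (∏ k, |M k 0|) * ρ ^ N := by
    intro σ
    have h1 : |((Equiv.Perm.sign σ : ℤ) : ℝ)| = 1 := by
      rcases Int.units_eq_one_or (Equiv.Perm.sign σ) with h | h <;> simp [h]
    rw [abs_mul, h1, one_mul, Finset.abs_prod, ← Equiv.prod_comp σ (fun k => |M k 0|),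
      Fin.prod_univ_succ, Fin.prod_univ_succ, mul_assoc]
    have h0 : |B (σ 0) 0| = |M (σ 0) 0| := by simp [hB]
    rw [h0]
    refine mul_le_mul_of_nonneg_left ?_ (abs_nonneg _)
    calc ∏ i : Fin N, |B (σ i.succ) i.succ| ≤ ∏ i : Fin N, ρ * |M (σ i.succ) 0| := by
          refine Finset.prod_le_prod (fun _ _ => abs_nonneg _) fun i _ => ?_
          simpa [hB, mul_comm] using hM (σ i.succ) i
      _ = _ := by
        rw [Finset.prod_mul_distrib, mul_comm]
        simp
  refine (Finset.abs_sum_le_sum_abs _ _).trans ((Finset.sum_le_sum fun σ _ => hterm σ).trans ?_)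
  rw [Finset.sum_const, Finset.card_univ, Fintype.card_perm, Fintype.card_fin, nsmul_eq_mul]
  exact le_of_eq (by ring)

/-- The simplex lemma: the integer vectors `q` with `|q 0|` small that represent rational points
within `ρ` of `x` lie in one linear hyperplane, because a determinant of `N + 1` of them is an
integer of absolute value less than `1`. -/
theorem exists_linear_form_of_small {N : ℕ} (x : Fin N → ℝ) {ρ : ℝ} (hρ : 0 ≤ ρ)
    (S : Set (Fin (N + 1) → ℤ))
    (hS : ∀ q ∈ S, |(q 0 : ℝ)| ^ (N + 1) * (ρ ^ N * (N + 1).factorial) < 1 ∧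
      ∀ i : Fin N, |(q i.succ : ℝ) - q 0 * x i| ≤ ρ * |(q 0 : ℝ)|) :
    ∃ a : Fin (N + 1) → ℝ, a ≠ 0 ∧ ∀ q ∈ S, ∑ j, a j * (q j : ℝ) = 0 := by
  classical
  set ι : (Fin (N + 1) → ℤ) → (Fin (N + 1) → ℝ) := fun q j => (q j : ℝ) with hι
  -- If the span were everything, `N + 1` of the vectors would have a nonzero integer determinant.
  by_cases htop : Submodule.span ℝ (ι '' S) = ⊤
  · exfalso
    obtain ⟨f, hfS, hli⟩ : ∃ f : Fin (N + 1) → (Fin (N + 1) → ℝ), (∀ k, f k ∈ ι '' S) ∧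
        LinearIndependent ℝ f := by
      obtain ⟨f, hfS, -, hli⟩ := Submodule.exists_fun_fin_finrank_span_eq ℝ (ι '' S)
      have hcard : N + 1 = Module.finrank ℝ (Submodule.span ℝ (ι '' S)) := by
        rw [htop, finrank_top, Module.finrank_fin_fun]
      exact ⟨f ∘ Fin.cast hcard, fun k => hfS _, hli.comp _ (Fin.cast_injective hcard)⟩
    choose q hqS hqf using hfS
    set A : Matrix (Fin (N + 1)) (Fin (N + 1)) ℤ := Matrix.of q with hA
    have hAf : A.map (Int.castRingHom ℝ) = Matrix.of f := by
      ext k j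
      simp [hA, ← hqf, hι]
    have hunit : IsUnit (Matrix.of f) := Matrix.linearIndependent_rows_iff_isUnit.1 hli
    have hdetf : (Matrix.of f).det = (A.det : ℝ) := by
      rw [← hAf, ← RingHom.mapMatrix_apply, ← RingHom.map_det]
      simp
    have hdet0 : A.det ≠ 0 := by
      intro h0
      rw [Matrix.isUnit_iff_isUnit_det, hdetf, h0] at hunit
      simp at hunit
    have hdet1 : (1 : ℝ) ≤ |(Matrix.of f).det| := by
      rw [hdetf]
      exact_mod_cast Int.one_le_abs hdet0
    have hle := abs_det_le_of_close x (ρ := ρ) (Matrix.of f) fun k i => by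
      simpa [← hqf, hι] using (hS _ (hqS k)).2 i
    obtain ⟨k₀, hk₀⟩ := Finite.exists_max fun k => |Matrix.of f k 0|
    have hprod : ∏ k, |Matrix.of f k 0| ≤ |(q k₀ 0 : ℝ)| ^ (N + 1) := by
      calc ∏ k, |Matrix.of f k 0| ≤ ∏ _k : Fin (N + 1), |Matrix.of f k₀ 0| :=
            Finset.prod_le_prod (fun _ _ => abs_nonneg _) fun k _ => hk₀ k
        _ = _ := by simp [← hqf, hι]
    have := mul_le_mul_of_nonneg_right hprod
      (show 0 ≤ ρ ^ N * ((N + 1).factorial : ℝ) by positivity)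
    linarith [(hS _ (hqS k₀)).1]
  · obtain ⟨f, hf0, hf⟩ := Submodule.exists_le_ker_of_lt_top _ (lt_top_iff_ne_top.2 htop)
    refine ⟨fun j => f (Pi.single j 1), ?_, fun q hq => ?_⟩
    · intro h
      apply hf0
      ext j
      simpa using congrFun h j
    · have : f (ι q) = 0 := hf (Submodule.subset_span ⟨q, hq, rfl⟩)
      rw [← this, pi_eq_sum_univ' (ι q), map_sum]
      refine Finset.sum_congr rfl fun j _ => ?_
      rw [map_smul, smul_eq_mul, mul_comm]

/-! ### A Cantor set of badly approximable vectors -/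

/-- Among the points of the grid `{0, …, L - 1}ᴺ`, few lie near a given affine hyperplane: on each
line in the direction of a coordinate `i` with `a i ≠ 0`, the condition confines `k i` to an
interval of length `N`. -/
theorem card_near_hyperplane_le {N L : ℕ} (a : Fin N → ℝ) (A : ℝ) {i : Fin N} (hi : a i ≠ 0) :
    (Finset.univ.filter fun k : Fin N → Fin L =>
      |A + ∑ j, a j * ((k j : ℕ) : ℝ)| ≤ |a i| * (N / 2)).card ≤ (N + 1) * L ^ (N - 1) := by
  classical
  set S := Finset.univ.filter fun k : Fin N → Fin L =>
    |A + ∑ j, a j * ((k j : ℕ) : ℝ)| ≤ |a i| * (N / 2) with hS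
  let f : (Fin N → Fin L) → ({j : Fin N // j ≠ i} → Fin L) := fun k j => k j
  have hT : (Finset.univ : Finset ({j : Fin N // j ≠ i} → Fin L)).card = L ^ (N - 1) := by
    simp [Fintype.card_subtype_compl]
  rw [← hT]
  refine Finset.card_le_mul_card_image_of_maps_to (f := f) (fun _ _ => Finset.mem_univ _) _ ?_
  intro b _
  set w : ℝ := (A + ∑ j : {j : Fin N // j ≠ i}, a j * ((b j : ℕ) : ℝ)) / a i with hw
  have hcard : (Finset.Icc ⌈-w - N / 2⌉ ⌊-w + N / 2⌋).card ≤ N + 1 := by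
    rw [Int.card_Icc, Int.toNat_le]
    have h1 := Int.floor_le (-w + N / 2)
    have h2 := Int.le_ceil (-w - (N : ℝ) / 2)
    have : ((⌊-w + (N : ℝ) / 2⌋ : ℤ) : ℝ) ≤ (⌈-w - (N : ℝ) / 2⌉ : ℤ) + N := by linarith
    have : ⌊-w + (N : ℝ) / 2⌋ ≤ ⌈-w - (N : ℝ) / 2⌉ + N := by exact_mod_cast this
    push_cast
    linarith
  refine le_trans (Finset.card_le_card_of_injOn (fun k => ((k i : ℕ) : ℤ)) ?_ ?_) hcard
  · intro k hk
    simp only [hS, Finset.coe_filter, Finset.mem_filter, Finset.mem_univ, true_and,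
      Set.mem_ofPred_eq] at hk
    obtain ⟨hk1, rfl⟩ := hk
    have hsum : A + ∑ j, a j * ((k j : ℕ) : ℝ) = a i * (w + (k i : ℕ)) := by
      rw [hw, mul_add, mul_div_cancel₀ _ hi, ← Finset.add_sum_erase _ _ (Finset.mem_univ i),
        Finset.sum_subtype (Finset.univ.erase i) (p := fun j => j ≠ i) (by simp)]
      ring
    rw [hsum, abs_mul] at hk1
    have hk2 := abs_le.1 (le_of_mul_le_mul_left hk1 (abs_pos.2 hi))
    simp only [Finset.coe_Icc, Set.mem_Icc, Int.ceil_le, Int.le_floor]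
    push_cast
    constructor <;> linarith [hk2.1, hk2.2]
  · intro k hk k' hk' h
    simp only [Finset.coe_filter, Set.mem_ofPred_eq] at hk hk'
    funext j
    by_cases hj : j = i
    · subst hj
      exact Fin.ext (Int.ofNat_inj.1 h)
    · exact congrFun (hk.2.trans hk'.2.symm) ⟨j, hj⟩

/-- One step of the Cantor construction: inside the ball of radius `ρ` around `x` there are `m`
well-separated balls of radius `ρ / (4L)` whose points stay at distance at least `ρ / (4L)` from
every rational point with denominator `q 0` small in terms of `ρ`. By the simplex lemma the
rational points to be avoided lie on one hyperplane, which meets few of the `L ^ N` candidate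
balls. -/
theorem exists_children {N L m : ℕ} (hN : 0 < N) (hL : 0 < L)
    (hm : m + (N + 1) * L ^ (N - 1) ≤ L ^ N) (x : Fin N → ℝ) {ρ : ℝ} (hρ : 0 < ρ) :
    ∃ child : Fin m → Fin N → ℝ,
      (∀ k, dist (child k) x ≤ ρ - ρ / (4 * L)) ∧
      (∀ k k', k ≠ k' → ρ / L ≤ dist (child k) (child k')) ∧
      ∀ k y, dist y (child k) ≤ ρ / (4 * L) → ∀ q : Fin (N + 1) → ℤ,
        |(q 0 : ℝ)| ^ (N + 1) * ((2 * ρ) ^ N * (N + 1).factorial) < 1 →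
          ∃ i : Fin N, ρ / (4 * L) * |(q 0 : ℝ)| ≤ |(q i.succ : ℝ) - q 0 * y i| := by
  classical
  have : Nonempty (Fin N) := ⟨⟨0, hN⟩⟩
  have hL' : (0 : ℝ) < L := by exact_mod_cast hL
  -- The candidate centres `c k` form a grid of mesh `4τ = ρ / L`; the new balls have radius `τ`.
  set τ : ℝ := ρ / (4 * L) with hτ
  have hτ0 : 0 < τ := by positivity
  have hρτ : ρ / L = 4 * τ := by rw [hτ]; field_simp
  have hρτ' : ρ = 4 * L * τ := by rw [hτ]; field_simp
  have hτρ : 4 * τ ≤ ρ := by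
    rw [← hρτ]
    exact div_le_self hρ.le (by exact_mod_cast hL)
  set c : (Fin N → Fin L) → Fin N → ℝ := fun k j => x j + 4 * τ * ((k j : ℕ) : ℝ) with hc
  have hcx : ∀ k, dist (c k) x ≤ ρ - τ := by
    intro k
    refine (dist_pi_le_iff (by linarith)).2 fun j => ?_
    have h1 : (((k j : ℕ) : ℝ)) + 1 ≤ L := by exact_mod_cast (k j).2
    simp only [hc, Real.dist_eq, add_sub_cancel_left]
    rw [abs_of_nonneg (by positivity)]
    nlinarith
  set S : Set (Fin (N + 1) → ℤ) :=
    {q | |(q 0 : ℝ)| ^ (N + 1) * ((2 * ρ) ^ N * (N + 1).factorial) < 1 ∧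
      ∀ i : Fin N, |(q i.succ : ℝ) - q 0 * x i| ≤ (2 * ρ) * |(q 0 : ℝ)|} with hS
  obtain ⟨a, ha0, ha⟩ := exists_linear_form_of_small x (by positivity : 0 ≤ 2 * ρ) S fun q hq => hq
  obtain ⟨i, hi⟩ := Finite.exists_max fun i : Fin N => |a i.succ|
  -- `G` consists of the grid points whose balls keep away from the hyperplane `a`.
  obtain ⟨G, hG, hGood⟩ : ∃ G : Finset (Fin N → Fin L), m ≤ G.card ∧ ∀ k ∈ G, ∀ q ∈ S, q 0 ≠ 0 →
      ¬ ∀ j : Fin N, |(q j.succ : ℝ) - q 0 * c k j| ≤ 2 * τ * |(q 0 : ℝ)| := by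
    -- If `a` is a multiple of the form `q ↦ q 0`, its kernel contains no affine rational point.
    by_cases hai : a i.succ = 0
    · refine ⟨Finset.univ, by simpa using le_trans (Nat.le_add_right _ _) hm, ?_⟩
      intro k _ q hq hq0 _
      have htail : ∀ j : Fin N, a j.succ = 0 := fun j => by simpa [hai] using hi j
      have h0 := ha q hq
      rw [Fin.sum_univ_succ] at h0
      simp only [htail, zero_mul, Finset.sum_const_zero, add_zero, mul_eq_zero, Int.cast_eq_zero,
        hq0, or_false] at h0
      apply ha0
      funext j
      refine Fin.cases h0 htail j
    · set A : ℝ := (a 0 + ∑ j : Fin N, a j.succ * x j) / (4 * τ) with hA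
      refine ⟨Finset.univ.filter fun k : Fin N → Fin L => ¬
        |A + ∑ j : Fin N, a j.succ * ((k j : ℕ) : ℝ)| ≤ |a i.succ| * (N / 2), ?_, ?_⟩
      · have h1 := card_near_hyperplane_le (L := L) (fun j : Fin N => a j.succ) A hai
        have h2 := Finset.card_filter_add_card_filter_not (s := Finset.univ)
          (fun k : Fin N → Fin L =>
            |A + ∑ j : Fin N, a j.succ * ((k j : ℕ) : ℝ)| ≤ |a i.succ| * (N / 2))
        have h3 : (Finset.univ : Finset (Fin N → Fin L)).card = L ^ N := by simp
        omega
      · intro k hk q hq hq0 hcl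
        rw [Finset.mem_filter] at hk
        apply hk.2
        have hq0' : 0 < |(q 0 : ℝ)| := abs_pos.2 (by exact_mod_cast hq0)
        have h0 := ha q hq
        rw [Fin.sum_univ_succ] at h0
        have hid : (q 0 : ℝ) * (4 * τ * (A + ∑ j : Fin N, a j.succ * ((k j : ℕ) : ℝ)))
            = - ∑ j : Fin N, a j.succ * ((q j.succ : ℝ) - q 0 * c k j) := by
          have e1 : 4 * τ * (A + ∑ j : Fin N, a j.succ * ((k j : ℕ) : ℝ))
              = a 0 + ∑ j : Fin N, a j.succ * c k j := by
            rw [mul_add, hA, mul_div_cancel₀ _ (by positivity), add_assoc, Finset.mul_sum,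
              ← Finset.sum_add_distrib]
            congr 1
            refine Finset.sum_congr rfl fun j _ => ?_
            simp only [hc]
            ring
          have e2 : ∑ j : Fin N, a j.succ * ((q j.succ : ℝ) - q 0 * c k j)
              = ∑ j : Fin N, a j.succ * (q j.succ : ℝ) - q 0 * ∑ j : Fin N, a j.succ * c k j := by
            rw [Finset.mul_sum, ← Finset.sum_sub_distrib]
            refine Finset.sum_congr rfl fun j _ => ?_
            ring
          rw [e1, e2]
          linarith
        have hle : |∑ j : Fin N, a j.succ * ((q j.succ : ℝ) - q 0 * c k j)|
            ≤ N * (|a i.succ| * (2 * τ * |(q 0 : ℝ)|)) := by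
          refine (Finset.abs_sum_le_sum_abs _ _).trans
            ((Finset.sum_le_card_nsmul _ _ (|a i.succ| * (2 * τ * |(q 0 : ℝ)|))
              fun j _ => ?_).trans (by simp))
          rw [abs_mul]
          exact mul_le_mul (hi j) (hcl j) (abs_nonneg _) (abs_nonneg _)
        rw [← abs_neg, ← hid, abs_mul, abs_mul, abs_of_pos (by positivity : 0 < 4 * τ)] at hle
        have : |(q 0 : ℝ)| * (4 * τ) * |A + ∑ j : Fin N, a j.succ * ((k j : ℕ) : ℝ)|
            ≤ |(q 0 : ℝ)| * (4 * τ) * (|a i.succ| * (N / 2)) := by linarith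
        exact le_of_mul_le_mul_left this (by positivity)
  obtain ⟨T, hTG, hT⟩ := Finset.exists_subset_card_eq hG
  let e := (T.equivFinOfCardEq hT).symm
  refine ⟨fun k => c (e k), fun k => hcx _, fun k k' hkk => ?_, fun k y hy q hq => ?_⟩
  · have hne : (e k : Fin N → Fin L) ≠ e k' := fun h => hkk (e.injective (Subtype.ext h))
    obtain ⟨j, hj⟩ := Function.ne_iff.1 hne
    refine le_trans ?_ (dist_le_pi_dist _ _ j)
    simp only [hc, Real.dist_eq, add_sub_add_left_eq_sub, ← mul_sub]
    rw [abs_mul, abs_of_pos (by positivity : 0 < 4 * τ), hρτ]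
    refine le_mul_of_one_le_right (by positivity) ?_
    have : ((e k : Fin N → Fin L) j : ℤ) - ((e k' : Fin N → Fin L) j : ℤ) ≠ 0 := by
      intro h
      apply hj
      apply Fin.ext
      omega
    exact_mod_cast Int.one_le_abs this
  · by_contra! hcon
    have hq0 : q 0 ≠ 0 := by
      intro h0
      have := hcon i
      simp only [h0, Int.cast_zero, abs_zero, mul_zero] at this
      exact absurd this (not_lt.2 (abs_nonneg _))
    have hmove : ∀ z : Fin N → ℝ, ∀ η : ℝ, dist y z ≤ η → ∀ j : Fin N,
        |(q j.succ : ℝ) - q 0 * z j| ≤ (τ + η) * |(q 0 : ℝ)| := by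
      intro z η hz j
      have h1 : |y j - z j| ≤ η := (dist_le_pi_dist y z j).trans hz
      calc |(q j.succ : ℝ) - q 0 * z j| = |((q j.succ : ℝ) - q 0 * y j) + q 0 * (y j - z j)| := by
            congr 1; ring
        _ ≤ |(q j.succ : ℝ) - q 0 * y j| + |(q 0 : ℝ) * (y j - z j)| := abs_add_le _ _
        _ ≤ τ * |(q 0 : ℝ)| + |(q 0 : ℝ)| * η := by
            rw [abs_mul]
            exact add_le_add (hcon j).le (mul_le_mul_of_nonneg_left h1 (abs_nonneg _))
        _ = _ := by ring
    refine hGood (e k) (hTG (e k).2) q ⟨hq, fun j => ?_⟩ hq0 fun j => ?_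
    · have hyx : dist y x ≤ ρ := by
        linarith [dist_triangle y (c (e k)) x, hcx (e k)]
      refine (hmove x ρ hyx j).trans (mul_le_mul_of_nonneg_right ?_ (abs_nonneg _))
      linarith
    · have := hmove _ τ hy j
      linarith

/-- A Cantor set of badly approximable points of `ℝᴺ`, with `m` pieces per step and contraction
ratio `1 / (4L)`. The conclusion about `q` is
`|q₀| ^ ((N + 1) / N) * ‖q' / q₀ - π a‖ ≥ c ^ (1 / N)`, cleared of denominators and roots. -/
theorem exists_badlyApproximable_coding {N L m : ℕ} (hN : 0 < N) (hL : 0 < L)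
    (hm : m + (N + 1) * L ^ (N - 1) ≤ L ^ N) :
    ∃ π : (ℕ → Fin m) → Fin N → ℝ, (∀ a, ‖π a‖ ≤ 1) ∧
      (∀ a b n, (∀ i < n, a i = b i) → a n ≠ b n →
        1 / (2 * L : ℝ) * ((4 * L : ℝ)⁻¹) ^ n ≤ dist (π a) (π b)) ∧
      ∃ c : ℝ, 0 < c ∧ ∀ a, ∀ q : Fin (N + 1) → ℤ, q 0 ≠ 0 →
        ∃ i : Fin N, c ≤ |(q 0 : ℝ)| * |(q i.succ : ℝ) - q 0 * π a i| ^ N := by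
  have hL' : (1 : ℝ) ≤ L := by exact_mod_cast hL
  set r : ℝ := (4 * L : ℝ)⁻¹ with hr
  have hr0 : 0 < r := by positivity
  have hr1 : r < 1 := inv_lt_one_of_one_lt₀ (by linarith)
  have hdiv : ∀ n, r ^ n / (4 * L) = r ^ (n + 1) := fun n => by
    rw [pow_succ, div_eq_mul_inv]
  choose child hc1 hc2 hc3 using fun (n : ℕ) (x : Fin N → ℝ) =>
    exists_children hN hL hm x (pow_pos hr0 n)
  -- `center a n` is the centre of the ball of step `n` with code `a`; its radius is `r ^ n`.
  let center : (ℕ → Fin m) → ℕ → Fin N → ℝ := fun a n =>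
    Nat.rec 0 (fun k x => child k x (a k)) n
  have hsucc : ∀ a n, center a (n + 1) = child n (center a n) (a n) := fun a n => rfl
  have hstep : ∀ a n, dist (center a n) (center a (n + 1)) ≤ (1 - r) * r ^ n := fun a n => by
    rw [hsucc, dist_comm]
    refine (hc1 n _ _).trans (le_of_eq ?_)
    rw [hdiv]
    ring
  have hlim : ∀ a, ∃ y, Filter.Tendsto (center a) Filter.atTop (nhds y) := fun a =>
    cauchySeq_tendsto_of_complete (cauchySeq_of_le_geometric r (1 - r) hr1 (hstep a))
  choose π hπ using hlim
  have hdist : ∀ a n, dist (center a n) (π a) ≤ r ^ n := fun a n => by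
    have := dist_le_of_le_geometric_of_tendsto r (1 - r) hr1 (hstep a) (hπ a) n
    rwa [mul_div_assoc, mul_div_cancel₀ _ (by linarith)] at this
  refine ⟨π, fun a => ?_, fun a b n hab hne => ?_, r ^ (2 * N) / (2 ^ N * (N + 1).factorial),
    by positivity, fun a q hq => ?_⟩
  · have := hdist a 0
    rw [dist_comm, pow_zero] at this
    simpa [center] using this
  · have hcen : ∀ k ≤ n, center a k = center b k := by
      intro k
      induction k with
      | zero => exact fun _ => rfl
      | succ k ih =>
        intro hk
        rw [hsucc, hsucc, ih (by omega), hab k (by omega)]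
    have h1 := hc2 n (center a n) (a n) (b n) hne
    rw [← hsucc, hcen n le_rfl, ← hsucc] at h1
    have h2 := hdist a (n + 1)
    have h3 := hdist b (n + 1)
    have h4 := dist_triangle4 (center a (n + 1)) (π a) (π b) (center b (n + 1))
    rw [dist_comm (π b)] at h4
    have h5 : r ^ n / L = 4 * r ^ (n + 1) := by rw [← hdiv]; field_simp
    have h6 : 1 / (2 * L : ℝ) * r ^ n = 2 * r ^ (n + 1) := by rw [← hdiv]; field_simp; norm_num
    linarith
  · have hq1 : (1 : ℝ) ≤ |(q 0 : ℝ)| := by exact_mod_cast Int.one_le_abs hq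
    set Q : ℝ := |(q 0 : ℝ)| with hQ
    set K : ℝ := 2 ^ N * (N + 1).factorial with hK
    have hK1 : 1 ≤ K := by
      have h1 : (1 : ℝ) ≤ 2 ^ N := one_le_pow₀ (by norm_num)
      have h2 : (1 : ℝ) ≤ (N + 1).factorial := by exact_mod_cast Nat.factorial_pos _
      nlinarith
    have hsmall : ∀ n, Q ^ (N + 1) * ((2 * r ^ n) ^ N * (N + 1).factorial)
        = Q ^ (N + 1) * K * (r ^ N) ^ n := fun n => by
      rw [hK, mul_pow, ← pow_mul, ← pow_mul, mul_comm n]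
      ring
    have hex : ∃ n, Q ^ (N + 1) * K * (r ^ N) ^ n < 1 := by
      obtain ⟨n, hn⟩ := exists_pow_lt_of_lt_one (y := r ^ N) (x := (Q ^ (N + 1) * K)⁻¹)
        (by positivity) (pow_lt_one₀ hr0.le hr1 hN.ne')
      refine ⟨n, ?_⟩
      rwa [← lt_inv_mul_iff₀ (by positivity), mul_one]
    classical
    -- The step `n` that takes care of `q` is the first at which its denominator counts as small.
    -- For `n > 0`, minimality bounds `|q 0|` from below in terms of the radius at step `n - 1`.
    obtain ⟨n, hn, hmin⟩ : ∃ n, Q ^ (N + 1) * K * (r ^ N) ^ n < 1 ∧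
        ∀ k < n, 1 ≤ Q ^ (N + 1) * K * (r ^ N) ^ k :=
      ⟨Nat.find hex, Nat.find_spec hex, fun k hk => not_lt.1 (Nat.find_min hex hk)⟩
    obtain ⟨i, hi⟩ := hc3 n (center a n) (a n) (π a)
      (by rw [← hsucc, hdiv, dist_comm]; exact hdist a (n + 1)) q (by rw [← hQ, hsmall]; exact hn)
    refine ⟨i, ?_⟩
    rw [hdiv] at hi
    have hfin : Q ^ (N + 1) * (r ^ N) ^ (n + 1) ≤ Q * |(q i.succ : ℝ) - q 0 * π a i| ^ N := by
      calc Q ^ (N + 1) * (r ^ N) ^ (n + 1) = Q * (r ^ (n + 1) * Q) ^ N := by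
            rw [mul_pow, ← pow_mul, ← pow_mul, mul_comm N (n + 1)]; ring
        _ ≤ _ := by gcongr
    refine le_trans ?_ hfin
    have hrN : 0 < r ^ N := by positivity
    have hrN1 : r ^ N ≤ 1 := pow_le_one₀ hr0.le hr1.le
    rw [mul_comm 2 N, pow_mul, div_le_iff₀ (by positivity)]
    rcases Nat.eq_zero_or_pos n with rfl | hnpos
    · have h1 : 1 ≤ Q ^ (N + 1) := one_le_pow₀ hq1
      have h2 : 1 ≤ Q ^ (N + 1) * K := one_le_mul_of_one_le_of_one_le h1 hK1
      calc (r ^ N) ^ 2 = r ^ N * r ^ N := sq _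
        _ ≤ r ^ N * 1 := by gcongr
        _ ≤ r ^ N * (Q ^ (N + 1) * K) := by gcongr
        _ = _ := by ring
    · obtain ⟨k, rfl⟩ := Nat.exists_eq_succ_of_ne_zero hnpos.ne'
      have h1 := hmin k (Nat.lt_succ_self k)
      calc (r ^ N) ^ 2 ≤ (r ^ N) ^ 2 * (Q ^ (N + 1) * K * (r ^ N) ^ k) :=
            le_mul_of_one_le_right (by positivity) h1
        _ = _ := by rw [Nat.succ_eq_add_one]; ring

namespace ProjBad

open MeasureTheory

/-! ### Estimates for the projective metric -/

theorem abs_wedge_coord_le {N : ℕ} (v w : Vec N) {i j : Fin (N + 1)} (hij : i < j) :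
    |v i * w j - v j * w i| ≤ wedgeNorm v w := by
  rw [← Real.sqrt_sq_eq_abs, wedgeNorm]
  refine Real.sqrt_le_sqrt ?_
  have hnn : ∀ i' j' : Fin (N + 1),
      0 ≤ if i' < j' then (v i' * w j' - v j' * w i') ^ 2 else 0 := fun i' j' => by
    split_ifs <;> positivity
  calc (v i * w j - v j * w i) ^ 2
      = if i < j then (v i * w j - v j * w i) ^ 2 else 0 := by rw [if_pos hij]
    _ ≤ ∑ j', if i < j' then (v i * w j' - v j' * w i) ^ 2 else 0 :=
        Finset.single_le_sum (fun j' _ => hnn i j') (Finset.mem_univ j)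
    _ ≤ _ := Finset.single_le_sum
        (f := fun i' => ∑ j', if i' < j' then (v i' * w j' - v j' * w i') ^ 2 else 0)
        (fun i' _ => Finset.sum_nonneg fun j' _ => hnn i' j') (Finset.mem_univ i)

theorem norm_le_sqrt_mul {N : ℕ} {v : Vec N} {A : ℝ} (hA : 0 ≤ A) (hv : ∀ i, |v i| ≤ A) :
    ‖v‖ ≤ Real.sqrt (N + 1) * A := by
  rw [EuclideanSpace.norm_eq, ← Real.sqrt_sq hA, ← Real.sqrt_mul (by positivity)]
  refine Real.sqrt_le_sqrt ?_
  refine (Finset.sum_le_card_nsmul _ _ (A ^ 2) fun i _ => ?_).trans (by simp)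
  rw [Real.norm_eq_abs]
  exact pow_le_pow_left₀ (abs_nonneg _) (hv i) 2

/-- The bivector coordinates `v₀ wⱼ - vⱼ w₀` bound the projective distance from below; `A` and `B`
are bounds for the coordinates of `v` and `w`. -/
theorem le_dist_mk_mk {N : ℕ} {v w : Vec N} (hv : v ≠ 0) (hw : w ≠ 0) {A B : ℝ}
    (hA : ∀ i, |v i| ≤ A) (hB : ∀ i, |w i| ≤ B) (j : Fin N) :
    |v 0 * w j.succ - v j.succ * w 0| / ((N + 1) * (A * B)) ≤
      dist (Projectivization.mk ℝ v hv : RealProj N) (Projectivization.mk ℝ w hw) := by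
  change _ ≤ delta _ _
  rw [delta_mk_mk]
  have hA0 : 0 ≤ A := (abs_nonneg _).trans (hA 0)
  have hB0 : 0 ≤ B := (abs_nonneg _).trans (hB 0)
  refine div_le_div₀ (Real.sqrt_nonneg _) (abs_wedge_coord_le v w (Fin.succ_pos j))
    (mul_pos (norm_pos_iff.2 hv) (norm_pos_iff.2 hw)) ?_
  calc ‖v‖ * ‖w‖ ≤ (Real.sqrt (N + 1) * A) * (Real.sqrt (N + 1) * B) :=
        mul_le_mul (norm_le_sqrt_mul hA0 hA) (norm_le_sqrt_mul hB0 hB) (norm_nonneg _)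
          (by positivity)
    _ = (Real.sqrt (N + 1) * Real.sqrt (N + 1)) * (A * B) := by ring
    _ = _ := by rw [Real.mul_self_sqrt (by positivity)]

theorem dist_mk_mk_le {N : ℕ} {v w : Vec N} (hv : v ≠ 0) (hw : w ≠ 0) :
    dist (Projectivization.mk ℝ v hv : RealProj N) (Projectivization.mk ℝ w hw)
      ≤ ‖v - w‖ / ‖w‖ := by
  change delta _ _ ≤ _
  have hv0 : 0 < ‖v‖ := norm_pos_iff.2 hv
  have hw0 : 0 < ‖w‖ := norm_pos_iff.2 hw
  rw [delta_mk_mk, div_le_div_iff₀ (by positivity) hw0]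
  have h1 : wedgeNorm v w ≤ ‖v‖ * ‖v - w‖ := by
    rw [wedgeNorm_eq]
    refine Real.sqrt_le_iff.2 ⟨by positivity, ?_⟩
    rw [mul_pow, norm_sub_sq_real]
    nlinarith [sq_nonneg (‖v‖ ^ 2 - inner ℝ v w)]
  calc wedgeNorm v w * ‖w‖ ≤ (‖v‖ * ‖v - w‖) * ‖w‖ := by gcongr
    _ = _ := by ring

/-! ### Affine charts -/

/-- The vector with coordinate `1` at place `i` and the coordinates of `x` at the other places. -/
noncomputable def chartVec {N : ℕ} (i : Fin (N + 1)) (x : Fin N → ℝ) : Vec N :=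
  WithLp.toLp 2 (i.insertNth (1 : ℝ) x : Fin (N + 1) → ℝ)

@[simp] theorem chartVec_same {N : ℕ} (i : Fin (N + 1)) (x : Fin N → ℝ) : chartVec i x i = 1 := by
  simp [chartVec]

@[simp] theorem chartVec_succAbove {N : ℕ} (i : Fin (N + 1)) (x : Fin N → ℝ) (j : Fin N) :
    chartVec i x (i.succAbove j) = x j := by
  simp [chartVec]

@[simp] theorem chartVec_zero_succ {N : ℕ} (x : Fin N → ℝ) (j : Fin N) :
    chartVec 0 x j.succ = x j := by
  simpa using chartVec_succAbove 0 x j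

theorem abs_chartVec_le_one {N : ℕ} (i : Fin (N + 1)) {x : Fin N → ℝ} (hx : ‖x‖ ≤ 1)
    (k : Fin (N + 1)) : |chartVec i x k| ≤ 1 := by
  rcases Fin.eq_self_or_eq_succAbove i k with rfl | ⟨j, rfl⟩
  · simp
  · rw [chartVec_succAbove]
    exact (norm_le_pi_norm x j).trans hx

theorem one_le_norm_chartVec {N : ℕ} (i : Fin (N + 1)) (x : Fin N → ℝ) : 1 ≤ ‖chartVec i x‖ := by
  simpa using PiLp.norm_apply_le (chartVec i x) i

theorem chartVec_ne_zero {N : ℕ} (i : Fin (N + 1)) (x : Fin N → ℝ) : chartVec i x ≠ 0 :=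
  norm_pos_iff.1 (one_pos.trans_le (one_le_norm_chartVec i x))

/-- The inverse of the `i`-th affine chart: it sends `x` to the point with homogeneous coordinates
`x`, with `1` inserted at place `i`. -/
noncomputable def chart {N : ℕ} (i : Fin (N + 1)) (x : Fin N → ℝ) : RealProj N :=
  Projectivization.mk ℝ (chartVec i x) (chartVec_ne_zero i x)

theorem lipschitzWith_chart {N : ℕ} (i : Fin (N + 1)) :
    LipschitzWith (Real.toNNReal (Real.sqrt (N + 1))) (chart i : (Fin N → ℝ) → RealProj N) := by
  refine LipschitzWith.of_dist_le_mul fun x y => ?_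
  rw [Real.coe_toNNReal _ (Real.sqrt_nonneg _)]
  refine (dist_mk_mk_le _ _).trans ((div_le_self (norm_nonneg _) (one_le_norm_chartVec i y)).trans
    (norm_le_sqrt_mul dist_nonneg fun k => ?_))
  rcases Fin.eq_self_or_eq_succAbove i k with rfl | ⟨j, rfl⟩
  · simp
  · simpa [Real.dist_eq] using dist_le_pi_dist x y j

theorem exists_chart_eq {N : ℕ} (p : RealProj N) : ∃ i x, chart i x = p := by
  induction p using Projectivization.ind with
  | h v hv =>
    obtain ⟨i, hi⟩ : ∃ i, v i ≠ 0 := by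
      by_contra! h
      exact hv (by ext i; simpa using h i)
    refine ⟨i, fun j => (v i)⁻¹ * v (i.succAbove j), ?_⟩
    rw [chart, Projectivization.mk_eq_mk_iff']
    refine ⟨(v i)⁻¹, ?_⟩
    ext k
    rcases Fin.eq_self_or_eq_succAbove i k with rfl | ⟨j, rfl⟩
    · simp [hi]
    · simp

theorem dimH_univ_le (N : ℕ) : dimH (Set.univ : Set (RealProj N)) ≤ N := by
  have hcov : (Set.univ : Set (RealProj N)) = ⋃ i : Fin (N + 1), Set.range (chart i) := by
    ext p
    simpa using exists_chart_eq p
  rw [hcov, dimH_iUnion]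
  refine iSup_le fun i => ((lipschitzWith_chart i).dimH_range_le).trans ?_
  rw [Real.dimH_univ_pi_fin]

/-! ### Hausdorff dimension of the badly approximable points -/

theorem exists_primitive_rep {N : ℕ} (p : RatProj N) :
    ∃ (q : Fin (N + 1) → ℤ) (h0 : (fun i => (q i : ℚ)) ≠ 0), Finset.univ.gcd q = 1 ∧
      p = Projectivization.mk ℚ (fun i => (q i : ℚ)) h0 := by
  induction p using Projectivization.ind with
  | h v hv =>
    obtain ⟨b, hb⟩ := IsLocalization.exist_integer_multiples_of_finite (nonZeroDivisors ℤ) v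
    choose u hu using hb
    obtain ⟨q, hq, hq1⟩ := Finset.extract_gcd u (Finset.univ_nonempty (α := Fin (N + 1)))
    set g := Finset.univ.gcd u with hg
    have hb0 : ((b : ℤ) : ℚ) ≠ 0 := by exact_mod_cast nonZeroDivisors.coe_ne_zero b
    have huv : ∀ i, (g : ℚ) * q i = (b : ℤ) * v i := fun i => by
      have h1 := hu i
      have h2 := hq i (Finset.mem_univ i)
      rw [h2] at h1
      simpa [Algebra.smul_def] using h1
    obtain ⟨i, hi⟩ := Function.ne_iff.1 hv
    have hg0 : (g : ℚ) ≠ 0 := by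
      intro h
      have := huv i
      rw [h, zero_mul] at this
      exact mul_ne_zero hb0 hi this.symm
    have hqv : (g / (b : ℤ) : ℚ) • (fun i => (q i : ℚ)) = v := by
      funext j
      have := huv j
      simp only [Pi.smul_apply, smul_eq_mul]
      field_simp
      linarith
    have h0 : (fun i => (q i : ℚ)) ≠ 0 := by
      intro h
      rw [h, smul_zero] at hqv
      exact hv hqv.symm
    refine ⟨q, h0, hq1, ?_⟩
    rw [Projectivization.mk_eq_mk_iff']
    exact ⟨_, hqv⟩

/-- A bounded vector that is badly approximable in the affine sense is a badly approximable point
of projective space. Rational points at infinity (`q 0 = 0`) need no hypothesis. -/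
theorem chart_mem_Bad {N : ℕ} (hN : 0 < N) {x : Fin N → ℝ} (hx : ‖x‖ ≤ 1) {c : ℝ} (hc : 0 < c)
    (h : ∀ q : Fin (N + 1) → ℤ, q 0 ≠ 0 →
      ∃ i : Fin N, c ≤ |(q 0 : ℝ)| * |(q i.succ : ℝ) - q 0 * x i| ^ N) :
    chart 0 x ∈ Bad N := by
  have hne : Nonempty (RatProj N) := inferInstance
  set c' : ℝ := min 1 (min 1 c / (N + 1) ^ N) with hc'
  have hc0 : 0 < c' := by positivity
  refine hc0.trans_le (le_ciInf fun p => ?_)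
  obtain ⟨q, h0, hgcd, rfl⟩ := exists_primitive_rep p
  rw [height_mk q hgcd h0]
  set H : ℤ := ⨆ i, |q i| with hH
  have hqH : ∀ i, |q i| ≤ H := fun i =>
    le_ciSup (f := fun i => |q i|) (Set.finite_range _).bddAbove i
  have hqH' : ∀ i, |(q i : ℝ)| ≤ H := fun i => by exact_mod_cast hqH i
  obtain ⟨i₀, hi₀⟩ : ∃ i, q i ≠ 0 := by
    by_contra! hq
    exact h0 (by funext i; simp [hq i])
  have hH1 : (1 : ℝ) ≤ H := by exact_mod_cast (Int.one_le_abs hi₀).trans (hqH i₀)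
  obtain ⟨j, hj⟩ : ∃ j : Fin N, min 1 c ≤ H * |(q j.succ : ℝ) - q 0 * x j| ^ N := by
    by_cases hq0 : q 0 = 0
    · obtain ⟨j, rfl⟩ := Fin.exists_succ_eq.2 (fun hh : i₀ = 0 => hi₀ (hh ▸ hq0))
      refine ⟨j, (min_le_left _ _).trans ?_⟩
      have : (1 : ℝ) ≤ |(q j.succ : ℝ)| := by exact_mod_cast Int.one_le_abs hi₀
      simp only [hq0, Int.cast_zero, zero_mul, sub_zero]
      exact one_le_mul_of_one_le_of_one_le hH1 (one_le_pow₀ this)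
    · obtain ⟨j, hj⟩ := h q hq0
      refine ⟨j, (min_le_right _ _).trans (hj.trans ?_)⟩
      gcongr
      exact hqH' 0
  set w : Vec N := WithLp.toLp 2 fun i => (q i : ℝ) with hw
  have hw0 : w ≠ 0 := by
    intro hw0
    have := congrArg (fun u : Vec N => u i₀) hw0
    simp [hw, hi₀] at this
  have hrat : ratPoint (Projectivization.mk ℚ (fun i => (q i : ℚ)) h0)
      = Projectivization.mk ℝ w hw0 := by
    rw [ratPoint, Projectivization.map_mk]
    rfl
  rw [hrat]
  have hd := le_dist_mk_mk (chartVec_ne_zero 0 x) hw0 (A := 1) (B := H)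
    (abs_chartVec_le_one 0 hx)
    (fun i => by simpa [hw] using hqH' i) j
  change _ ≤ dist (chart 0 x) _ at hd
  set D := |(q j.succ : ℝ) - q 0 * x j| with hD
  have hD' : |chartVec 0 x 0 * w j.succ - chartVec 0 x j.succ * w 0| = D := by
    simp [hw, hD, mul_comm]
  rw [hD', one_mul] at hd
  set t : ℝ := (H : ℝ) ^ (((N : ℝ) + 1) / N) * dist (chart 0 x) (Projectivization.mk ℝ w hw0)
    with ht
  have ht0 : 0 ≤ t := by positivity
  have hN' : (N : ℝ) ≠ 0 := by exact_mod_cast hN.ne'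
  -- Raising to the power `N` clears the fractional exponent `(N + 1) / N`.
  have htN : min 1 c / (N + 1) ^ N ≤ t ^ N := by
    have e1 : ((H : ℝ) ^ (((N : ℝ) + 1) / N)) ^ N = (H : ℝ) ^ (N + 1) := by
      rw [← Real.rpow_natCast, ← Real.rpow_mul (by positivity), div_mul_cancel₀ _ hN']
      exact_mod_cast Real.rpow_natCast (H : ℝ) (N + 1)
    calc min 1 c / (N + 1) ^ N ≤ H * D ^ N / (N + 1) ^ N := by gcongr
      _ = (H : ℝ) ^ (N + 1) * (D / ((N + 1) * H)) ^ N := by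
        rw [div_pow, mul_pow, pow_succ]
        field_simp
      _ ≤ (H : ℝ) ^ (N + 1) * (dist (chart 0 x) (Projectivization.mk ℝ w hw0)) ^ N := by
        gcongr
      _ = t ^ N := by rw [ht, mul_pow, e1]
  by_cases ht1 : 1 ≤ t
  · exact (min_le_left _ _).trans ht1
  · exact (min_le_right _ _).trans (htN.trans (pow_le_of_le_one ht0 (not_le.1 ht1).le hN.ne'))

/-- The branching number `m = L ^ N - (N + 1) L ^ (N - 1)` of the Cantor construction beats any
power `(4L) ^ s` with `s < N` once `L` is large. -/
theorem exists_branching {N : ℕ} (hN : 0 < N) {s : ℝ} (hs : s < N) :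
    ∃ L m : ℕ, 0 < L ∧ 1 < m ∧ m + (N + 1) * L ^ (N - 1) ≤ L ^ N ∧ (4 * L : ℝ) ^ s ≤ m := by
  have hlim : Filter.Tendsto (fun L : ℕ => (L : ℝ) ^ ((N : ℝ) - s)) Filter.atTop Filter.atTop :=
    (tendsto_rpow_atTop (sub_pos.2 hs)).comp tendsto_natCast_atTop_atTop
  obtain ⟨L, hL1, hL2⟩ := ((hlim.eventually_ge_atTop (2 * 4 ^ s)).and
    (Filter.eventually_ge_atTop (2 * (N + 1)))).exists
  have hL0 : 0 < L := by omega
  obtain ⟨M, rfl⟩ : ∃ M, N = M + 1 := ⟨N - 1, by omega⟩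
  have hP : 1 ≤ L ^ M := Nat.one_le_pow _ _ hL0
  have hhalf : 2 * ((M + 1 + 1) * L ^ M) ≤ L ^ (M + 1) := by
    rw [pow_succ, mul_comm (L ^ M), ← mul_assoc]
    exact Nat.mul_le_mul_right _ hL2
  have hbig : 4 ≤ L ^ (M + 1) := by nlinarith
  refine ⟨L, L ^ (M + 1) - (M + 1 + 1) * L ^ M, hL0, ?_, ?_, ?_⟩
  · omega
  · simp only [Nat.add_sub_cancel]
    omega
  · have hL0' : (0 : ℝ) < L := by exact_mod_cast hL0
    have h1 : (L : ℝ) ^ (M + 1) ≤ 2 * ((L ^ (M + 1) - (M + 1 + 1) * L ^ M : ℕ) : ℝ) := by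
      exact_mod_cast (by omega : L ^ (M + 1) ≤ 2 * (L ^ (M + 1) - (M + 1 + 1) * L ^ M))
    rw [Real.rpow_sub hL0', Real.rpow_natCast, le_div_iff₀ (by positivity)] at hL1
    rw [Real.mul_rpow (by norm_num) hL0'.le]
    linarith

theorem dimH_Bad {N : ℕ} (hN : 0 < N) : dimH (Bad N) = (N : ENNReal) := by
  refine le_antisymm ((dimH_mono (Set.subset_univ _)).trans (dimH_univ_le N)) ?_
  refine ENNReal.le_of_forall_nnreal_lt fun s hs => ?_
  rcases eq_or_ne s 0 with rfl | hs0
  · simp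
  have hsN : (s : ℝ) < N := by exact_mod_cast hs
  obtain ⟨L, m, hL, hm1, hm, hLm⟩ := exists_branching hN hsN
  obtain ⟨π, hπ1, hsep, c, hc, hbad⟩ := exists_badlyApproximable_coding hN hL hm
  have hL' : (0 : ℝ) < L := by exact_mod_cast hL
  refine (le_dimH_range_of_separated_coding hm1 (θ := 4 * L) (c := 1 / (2 * L) / (N + 1))
    (by positivity) (by positivity) (pos_iff_ne_zero.2 hs0) hLm (fun a => chart 0 (π a))
    fun a b n hab hne => ?_).trans (dimH_mono ?_)
  · have h1 := hsep a b n hab hne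
    have h2 : dist (π a) (π b) ≤ (N + 1) * dist (chart 0 (π a)) (chart 0 (π b)) := by
      refine (dist_pi_le_iff (by positivity)).2 fun j => ?_
      have := le_dist_mk_mk (chartVec_ne_zero 0 (π a)) (chartVec_ne_zero 0 (π b))
        (abs_chartVec_le_one 0 (hπ1 a)) (abs_chartVec_le_one 0 (hπ1 b)) j
      rw [div_le_iff₀ (by positivity)] at this
      rw [dist_comm, Real.dist_eq]
      simpa [chart, mul_comm] using this
    rw [div_mul_eq_mul_div, div_le_iff₀ (by positivity)]
    linarith
  · rintro _ ⟨a, rfl⟩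
    exact chart_mem_Bad hN (hπ1 a) hc (hbad a)

/-! ### Measurability and orthonormal coordinates -/

theorem continuous_mk' (N : ℕ) :
    Continuous (Projectivization.mk' ℝ : {v : Vec N // v ≠ 0} → RealProj N) := by
  rw [continuous_iff_continuousAt]
  intro w
  rw [ContinuousAt, tendsto_iff_dist_tendsto_zero]
  have hlim : Filter.Tendsto (fun v : {v : Vec N // v ≠ 0} => ‖(v : Vec N) - w‖ / ‖(w : Vec N)‖)
      (nhds w) (nhds 0) := by
    have : Continuous fun v : {v : Vec N // v ≠ 0} => ‖(v : Vec N) - w‖ / ‖(w : Vec N)‖ := by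
      fun_prop
    simpa using this.tendsto w
  exact squeeze_zero (fun _ => dist_nonneg) (fun v => dist_mk_mk_le v.2 w.2) hlim

instance instOpensMeasurableSpaceRealProj (N : ℕ) : OpensMeasurableSpace (RealProj N) where
  borel_le := MeasurableSpace.generateFrom_le fun _ hs =>
    ((continuous_mk' N).isOpen_preimage _ hs).measurableSet

/-- Taking coordinates in an orthonormal basis preserves Lebesgue measure. -/
theorem measurePreserving_coords {N : ℕ} (b : OrthonormalBasis (Fin (N + 1)) ℝ (Vec N)) :
    MeasurePreserving (fun v : Vec N => (b.repr v).ofLp) :=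
  (PiLp.volume_preserving_ofLp (Fin (N + 1))).comp b.measurePreserving_repr

/-- Upper bound for `projMeasure N M` by the volume of a set `T` that contains the part in the unit
ball of the cone over `M`, in the coordinates of an orthonormal basis. -/
theorem projMeasure_le {N : ℕ} (b : OrthonormalBasis (Fin (N + 1)) ℝ (Vec N))
    {M : Set (RealProj N)} (hM : MeasurableSet M) {T : Set (Fin (N + 1) → ℝ)}
    (hT : MeasurableSet T)
    (h : ∀ (v : Vec N) (hv : v ≠ 0), ‖v‖ ≤ 1 → Projectivization.mk ℝ v hv ∈ M →
      (b.repr v).ofLp ∈ T) :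
    projMeasure N M ≤ volume T / volume (Metric.closedBall (0 : Vec N) 1) := by
  rw [projMeasure_apply hM, ← (measurePreserving_coords b).measure_preimage hT.nullMeasurableSet]
  refine ENNReal.div_le_div_right (measure_mono ?_) _
  rintro v ⟨⟨hv, hvM⟩, hv1⟩
  exact h v hv (by simpa using hv1) hvM

/-- Lower bound for `projMeasure N M` by the volume of a set `T` contained in the part in the unit
ball of the cone over `M`, in the coordinates of an orthonormal basis. -/
theorem le_projMeasure {N : ℕ} (b : OrthonormalBasis (Fin (N + 1)) ℝ (Vec N))
    {M : Set (RealProj N)} (hM : MeasurableSet M) {T : Set (Fin (N + 1) → ℝ)}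
    (hT : MeasurableSet T)
    (h : ∀ v : Vec N, (b.repr v).ofLp ∈ T →
      ∃ hv : v ≠ 0, ‖v‖ ≤ 1 ∧ Projectivization.mk ℝ v hv ∈ M) :
    volume T / volume (Metric.closedBall (0 : Vec N) 1) ≤ projMeasure N M := by
  rw [projMeasure_apply hM, ← (measurePreserving_coords b).measure_preimage hT.nullMeasurableSet]
  refine ENNReal.div_le_div_right (measure_mono ?_) _
  intro v hv
  obtain ⟨hv0, hv1, hvM⟩ := h v hv
  exact ⟨⟨hv0, hvM⟩, by simpa using hv1⟩

theorem exists_orthonormalBasis_zero_eq {N : ℕ} {x : Vec N} (hx : ‖x‖ = 1) :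
    ∃ b : OrthonormalBasis (Fin (N + 1)) ℝ (Vec N), b 0 = x := by
  have hv : Orthonormal ℝ (({0} : Set (Fin (N + 1))).domRestrict fun _ => x) := by
    refine ⟨fun _ => hx, fun i j hij => absurd (Subsingleton.elim i j) hij⟩
  obtain ⟨b, hb⟩ := hv.exists_orthonormalBasis_extension_of_card_eq (by simp)
  exact ⟨b, hb 0 rfl⟩

theorem norm_sq_coords {N : ℕ} (b : OrthonormalBasis (Fin (N + 1)) ℝ (Vec N)) (v : Vec N) :
    ‖v‖ ^ 2 = b.repr v 0 ^ 2 + ∑ j : Fin N, b.repr v j.succ ^ 2 := by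
  rw [← b.repr.norm_map v, EuclideanSpace.real_norm_sq_eq, Fin.sum_univ_succ]

/-- In an orthonormal basis starting with a representative of the centre, the cone over a ball of
radius `r` is `|w'| ≤ r |w|`, where `w'` collects the coordinates of `w` other than the first. -/
theorem dist_mk_le_iff {N : ℕ} (b : OrthonormalBasis (Fin (N + 1)) ℝ (Vec N)) {v : Vec N}
    (hv : v ≠ 0) (hb : b 0 ≠ 0) {r : ℝ} (hr : 0 ≤ r) :
    dist (Projectivization.mk ℝ v hv : RealProj N) (Projectivization.mk ℝ (b 0) hb) ≤ r ↔
      ∑ j : Fin N, b.repr v j.succ ^ 2 ≤ r ^ 2 * ‖v‖ ^ 2 := by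
  change delta _ _ ≤ r ↔ _
  have hv0 : 0 < ‖v‖ := norm_pos_iff.2 hv
  have h0 : b.repr v 0 = inner ℝ v (b 0) := by rw [b.repr_apply_apply, real_inner_comm]
  rw [delta_mk_mk, b.norm_eq_one, mul_one, div_le_iff₀ hv0, wedgeNorm_eq, b.norm_eq_one,
    Real.sqrt_le_left (by positivity), ← h0, mul_pow]
  have := norm_sq_coords b v
  constructor <;> intro h <;> linarith

/-! ### Ahlfors regularity -/

theorem ofReal_le_projMeasure_closedBall {N : ℕ} (p : RealProj N) {r : ℝ} (hr : 0 < r)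
    (hr1 : r ≤ 1) :
    ENNReal.ofReal ((4 * ((N : ℝ) + 1) ^ N)⁻¹ * r ^ N) / volume (Metric.closedBall (0 : Vec N) 1) ≤
      projMeasure N (Metric.closedBall p r) := by
  obtain ⟨x, hx0, hx, rfl⟩ := exists_unit_rep p
  obtain ⟨b, rfl⟩ := exists_orthonormalBasis_zero_eq hx
  -- The box `[1/2, 3/4] × [-ρ, ρ]ᴺ` lies in the unit ball and in the cone over the `r`-ball.
  set ρ : ℝ := r / (2 * (N + 1)) with hρ
  have hρ0 : 0 < ρ := by positivity
  set l : Fin (N + 1) → ℝ := Fin.cons (1 / 2) fun _ => -ρ with hl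
  set u : Fin (N + 1) → ℝ := Fin.cons (3 / 4) fun _ => ρ with hu
  have hvol : volume (Set.Icc l u) = ENNReal.ofReal ((4 * ((N : ℝ) + 1) ^ N)⁻¹ * r ^ N) := by
    rw [Real.volume_Icc_pi, ← ENNReal.ofReal_prod_of_nonneg, Fin.prod_univ_succ]
    · congr 1
      simp only [hl, hu, Fin.cons_zero, Fin.cons_succ, Finset.prod_const, Finset.card_univ,
        Fintype.card_fin]
      have : ρ - -ρ = r / (N + 1) := by rw [hρ]; field_simp; norm_num
      rw [this, div_pow]
      field_simp
      norm_num
    · intro i _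
      refine Fin.cases ?_ (fun j => ?_) i
      · norm_num [hl, hu]
      · simp only [hl, hu, Fin.cons_succ]
        linarith
  rw [← hvol]
  refine le_projMeasure b Metric.isClosed_closedBall.measurableSet measurableSet_Icc fun v hv => ?_
  have h0 : 1 / 2 ≤ b.repr v 0 ∧ b.repr v 0 ≤ 3 / 4 := ⟨hv.1 0, hv.2 0⟩
  have hj : ∀ j : Fin N, b.repr v j.succ ^ 2 ≤ ρ ^ 2 := fun j =>
    sq_le_sq' (hv.1 j.succ) (hv.2 j.succ)
  have hsum : ∑ j : Fin N, b.repr v j.succ ^ 2 ≤ r ^ 2 / 4 := by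
    refine (Finset.sum_le_card_nsmul _ _ _ fun j _ => hj j).trans ?_
    rw [Finset.card_univ, Fintype.card_fin, nsmul_eq_mul, hρ, div_pow, mul_pow, mul_div_assoc',
      div_le_div_iff₀ (by positivity) (by norm_num)]
    have : (N : ℝ) ≤ (N + 1) ^ 2 := by nlinarith [(Nat.cast_nonneg N : (0 : ℝ) ≤ N)]
    nlinarith [mul_le_mul_of_nonneg_left this (sq_nonneg r)]
  have hnorm := norm_sq_coords b v
  have hsum0 : 0 ≤ ∑ j : Fin N, b.repr v j.succ ^ 2 := Finset.sum_nonneg fun _ _ => sq_nonneg _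
  have hr2 : r ^ 2 ≤ 1 := pow_le_one₀ hr.le hr1
  have hlow : 1 / 4 ≤ ‖v‖ ^ 2 := by nlinarith [h0.1]
  have hv0 : v ≠ 0 := by
    rintro rfl
    norm_num at hlow
  refine ⟨hv0, ?_, ?_⟩
  · refine le_of_sq_le_sq ?_ zero_le_one
    nlinarith [h0.1, h0.2]
  · rw [Metric.mem_closedBall, dist_mk_le_iff b hv0 hx0 hr.le]
    nlinarith [sq_nonneg r]

theorem coords_of_mem_closedBall {N : ℕ} (b : OrthonormalBasis (Fin (N + 1)) ℝ (Vec N))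
    (hb : b 0 ≠ 0) {r : ℝ} (hr : 0 < r) {v : Vec N} (hv : v ≠ 0) (hv1 : ‖v‖ ≤ 1)
    (h : (Projectivization.mk ℝ v hv : RealProj N) ∈
      Metric.closedBall (Projectivization.mk ℝ (b 0) hb) r) :
    |b.repr v 0| ≤ 1 ∧ ∀ j : Fin N, |b.repr v j.succ| ≤ r := by
  rw [Metric.mem_closedBall, dist_mk_le_iff b hv hb hr.le] at h
  have hnorm := norm_sq_coords b v
  have hsum0 : 0 ≤ ∑ j : Fin N, b.repr v j.succ ^ 2 := Finset.sum_nonneg fun _ _ => sq_nonneg _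
  have hn2 : ‖v‖ ^ 2 ≤ 1 := pow_le_one₀ (norm_nonneg _) hv1
  refine ⟨abs_le_of_sq_le_sq (by linarith) zero_le_one, fun j => abs_le_of_sq_le_sq ?_ hr.le⟩
  have h1 := Finset.single_le_sum (f := fun j : Fin N => b.repr v j.succ ^ 2)
    (fun _ _ => sq_nonneg _) (Finset.mem_univ j)
  nlinarith [sq_nonneg r]

theorem projMeasure_closedBall_le {N : ℕ} (p : RealProj N) {r : ℝ} (hr : 0 < r) :
    projMeasure N (Metric.closedBall p r) ≤
      ENNReal.ofReal (2 * 2 ^ N * r ^ N) / volume (Metric.closedBall (0 : Vec N) 1) := by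
  obtain ⟨x, hx0, hx, rfl⟩ := exists_unit_rep p
  obtain ⟨b, rfl⟩ := exists_orthonormalBasis_zero_eq hx
  set u : Fin (N + 1) → ℝ := Fin.cons 1 fun _ => r with hu
  have hvol : volume (Set.Icc (-u) u) = ENNReal.ofReal (2 * 2 ^ N * r ^ N) := by
    rw [Real.volume_Icc_pi, ← ENNReal.ofReal_prod_of_nonneg, Fin.prod_univ_succ]
    · congr 1
      simp only [hu, Pi.neg_apply, Fin.cons_zero, Fin.cons_succ, Finset.prod_const,
        Finset.card_univ, Fintype.card_fin]
      rw [sub_neg_eq_add r, ← two_mul r, mul_pow]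
      ring
    · intro i _
      refine Fin.cases ?_ (fun j => ?_) i
      · norm_num [hu]
      · simp only [hu, Pi.neg_apply, Fin.cons_succ]
        linarith
  rw [← hvol]
  refine projMeasure_le b Metric.isClosed_closedBall.measurableSet measurableSet_Icc
    fun v hv hv1 hvM => ?_
  obtain ⟨h0, hj⟩ := coords_of_mem_closedBall b hx0 hr hv hv1 hvM
  constructor <;> intro i <;> refine Fin.cases ?_ (fun j => ?_) i
  · exact (abs_le.1 h0).1
  · exact (abs_le.1 (hj j)).1
  · exact (abs_le.1 h0).2
  · exact (abs_le.1 (hj j)).2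

theorem volume_closedBall_eq_ofReal (N : ℕ) : ∃ V : ℝ, 0 < V ∧
    volume (Metric.closedBall (0 : Vec N) 1) = ENNReal.ofReal V := by
  have htop : volume (Metric.closedBall (0 : Vec N) 1) ≠ ⊤ := measure_closedBall_lt_top.ne
  refine ⟨(volume (Metric.closedBall (0 : Vec N) 1)).toReal, ENNReal.toReal_pos ?_ htop,
    (ENNReal.ofReal_toReal htop).symm⟩
  exact (Metric.measure_closedBall_pos volume (0 : Vec N) one_pos).ne'

theorem isAhlforsRegular_projMeasure {N : ℕ} (hN : 0 < N) :
    IsAhlforsRegular (projMeasure N) Set.univ (N : ℝ) := by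
  obtain ⟨V, hV, hVeq⟩ := volume_closedBall_eq_ofReal N
  refine ⟨by exact_mod_cast hN, 1, min 1 ((4 * ((N : ℝ) + 1) ^ N)⁻¹ / V), max 1 (2 * 2 ^ N / V),
    one_pos, by positivity, min_le_left _ _, le_max_left _ _, fun x _ r hr hr1 => ?_⟩
  rw [Real.rpow_natCast]
  constructor
  · refine le_trans ?_ (ofReal_le_projMeasure_closedBall x hr hr1.le)
    rw [hVeq, ← ENNReal.ofReal_div_of_pos hV, mul_div_right_comm]
    exact ENNReal.ofReal_le_ofReal
      (mul_le_mul_of_nonneg_right (min_le_right _ _) (by positivity))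
  · refine (projMeasure_closedBall_le x hr).trans ?_
    rw [hVeq, ← ENNReal.ofReal_div_of_pos hV, mul_div_right_comm]
    exact ENNReal.ofReal_le_ofReal
      (mul_le_mul_of_nonneg_right (le_max_right _ _) (by positivity))

/-! ### Decay near hyperplanes -/

/-- A projective hyperplane has a unit normal `n`: all its points have unit representatives
orthogonal to `n`. -/
theorem IsProjHyperplane.exists_unit_normal {N : ℕ} {P : Set (RealProj N)}
    (hP : IsProjHyperplane P) :
    ∃ n : Vec N, ‖n‖ = 1 ∧ ∀ p ∈ P, ∃ (y : Vec N) (hy : y ≠ 0), ‖y‖ = 1 ∧ inner ℝ y n = 0 ∧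
      Projectivization.mk ℝ y hy = p := by
  obtain ⟨L, hL, rfl⟩ := hP
  have hLtop : L ≠ ⊤ := by
    rintro rfl
    rw [finrank_top, finrank_euclideanSpace_fin] at hL
    omega
  obtain ⟨n, hn, hn0⟩ := Submodule.exists_mem_ne_zero_of_ne_bot
    (mt (Submodule.orthogonal_eq_bot_iff (K := L)).1 hLtop)
  refine ⟨‖n‖⁻¹ • n, norm_smul_inv_norm (𝕜 := ℝ) hn0, ?_⟩
  rintro p ⟨v, hv, hvL, rfl⟩
  have hv0 : ‖v‖ ≠ 0 := norm_ne_zero_iff.2 hv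
  refine ⟨‖v‖⁻¹ • v, smul_ne_zero (inv_ne_zero hv0) hv, norm_smul_inv_norm (𝕜 := ℝ) hv, ?_, ?_⟩
  · rw [inner_smul_left, inner_smul_right, hn v hvL]
    simp
  · rw [Projectivization.mk_eq_mk_iff']
    exact ⟨‖v‖⁻¹, rfl⟩

/-- The cone over the `ε`-neighbourhood of a hyperplane with unit normal `n` lies in the double
wedge `|⟨v, n⟩| ≤ ε ‖v‖`. -/
theorem abs_inner_le_of_mem_thickening {N : ℕ} {P : Set (RealProj N)} {n : Vec N} (hn : ‖n‖ = 1)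
    (hP : ∀ p ∈ P, ∃ (y : Vec N) (hy : y ≠ 0), ‖y‖ = 1 ∧ inner ℝ y n = 0 ∧
      Projectivization.mk ℝ y hy = p)
    {ε : ℝ} {v : Vec N} (hv : v ≠ 0) (h : Projectivization.mk ℝ v hv ∈ Metric.thickening ε P) :
    |inner ℝ v n| ≤ ε * ‖v‖ := by
  obtain ⟨p, hp, hd⟩ := Metric.mem_thickening_iff.1 h
  obtain ⟨y, hy, hy1, hyn, rfl⟩ := hP p hp
  change delta _ _ < ε at hd
  rw [delta_mk_mk, hy1, mul_one, div_lt_iff₀ (norm_pos_iff.2 hv)] at hd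
  refine le_trans ?_ hd.le
  have h1 : inner ℝ v n = inner ℝ (v - (inner ℝ v y : ℝ) • y) n := by
    rw [inner_sub_left, inner_smul_left, hyn, mul_zero, sub_zero]
  have h2 := abs_real_inner_le_norm (v - (inner ℝ v y : ℝ) • y) n
  rw [← h1, hn, mul_one] at h2
  refine h2.trans (le_of_eq ?_)
  rw [wedgeNorm_eq, hy1, ← Real.sqrt_sq (norm_nonneg (v - (inner ℝ v y : ℝ) • y)),
    norm_sub_sq_real, inner_smul_right, norm_smul, hy1, Real.norm_eq_abs, mul_one, sq_abs]
  congr 1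
  ring

/-- The volume of a box cut by a slab: replacing the coordinate `i + 1` by `∑ j, n j * w j` is a
linear map of determinant `n (i + 1)` that carries the set into a box with a side of length
`2ε`. -/
theorem volume_slab_box_le {N : ℕ} (n : Fin (N + 1) → ℝ) {i : Fin N} (hi : n i.succ ≠ 0)
    {r ε : ℝ} (hr : 0 < r) (hε : 0 < ε) :
    volume {w : Fin (N + 1) → ℝ | |w 0| ≤ 1 ∧ (∀ j : Fin N, |w j.succ| ≤ r) ∧
      |∑ j, n j * w j| ≤ ε} ≤
      ENNReal.ofReal (|n i.succ|⁻¹ * (4 * ε * (2 * r) ^ (N - 1))) := by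
  classical
  set A : Matrix (Fin (N + 1)) (Fin (N + 1)) ℝ :=
    ((1 : Matrix (Fin (N + 1)) (Fin (N + 1)) ℝ).updateCol i.succ n).transpose with hA
  have hdet : A.det = n i.succ := by
    rw [hA, Matrix.det_transpose, ← Matrix.cramer_apply, Matrix.cramer_one]
    rfl
  have hdet' : LinearMap.det (Matrix.toLin' A) = n i.succ := by
    rw [LinearMap.det_toLin', hdet]
  have hrow : ∀ w, Matrix.toLin' A w i.succ = ∑ j, n j * w j := fun w => by
    simp [hA, Matrix.toLin'_apply, Matrix.mulVec, dotProduct]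
  have hrow' : ∀ w k, k ≠ i.succ → Matrix.toLin' A w k = w k := fun w k hk => by
    simp [hA, Matrix.toLin'_apply, Matrix.mulVec, dotProduct, hk, Matrix.one_apply]
  set u : Fin (N + 1) → ℝ := Fin.cons 1 (Function.update (fun _ => r) i ε) with hu
  have hvol : volume (Set.Icc (-u) u) = ENNReal.ofReal (4 * ε * (2 * r) ^ (N - 1)) := by
    rw [Real.volume_Icc_pi, ← ENNReal.ofReal_prod_of_nonneg, Fin.prod_univ_succ]
    · congr 1
      simp only [hu, Pi.neg_apply, Fin.cons_zero, Fin.cons_succ]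
      rw [← Finset.mul_prod_erase _ _ (Finset.mem_univ i), Finset.prod_congr rfl
        (g := fun _ => 2 * r)]
      · simp
        ring
      · intro j hj
        rw [Function.update_of_ne (Finset.ne_of_mem_erase hj)]
        ring
    · intro k _
      refine Fin.cases ?_ (fun j => ?_) k
      · simp only [hu, Pi.neg_apply, Fin.cons_zero]
        norm_num
      · simp only [hu, Pi.neg_apply, Fin.cons_succ, Function.update_apply]
        split_ifs <;> linarith
  have hsub : {w : Fin (N + 1) → ℝ | |w 0| ≤ 1 ∧ (∀ j : Fin N, |w j.succ| ≤ r) ∧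
      |∑ j, n j * w j| ≤ ε} ⊆ Matrix.toLin' A ⁻¹' Set.Icc (-u) u := by
    rintro w ⟨h0, hj, hs⟩
    have key : ∀ k, |Matrix.toLin' A w k| ≤ u k := by
      intro k
      refine Fin.cases ?_ (fun j => ?_) k
      · rw [hrow' w 0 (Fin.succ_ne_zero i).symm]
        exact h0
      · by_cases hji : j = i
        · subst hji
          simpa [hrow, hu] using hs
        · rw [hrow' w j.succ (by simpa using hji)]
          simpa [hu, hji] using hj j
    exact ⟨fun k => (abs_le.1 (key k)).1, fun k => (abs_le.1 (key k)).2⟩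
  refine (measure_mono hsub).trans (le_of_eq ?_)
  rw [Measure.addHaar_preimage_linearMap _ (by rwa [hdet']), hdet', hvol,
    ← ENNReal.ofReal_mul (abs_nonneg _), abs_inv]

/-- If a ball of radius `r < 1 / 3` around `b 0` meets the `r`-neighbourhood of the hyperplane with
unit normal `n`, then `n` is not too close to `b 0`. -/
theorem sq_inner_zero_le_half {N : ℕ} (b : OrthonormalBasis (Fin (N + 1)) ℝ (Vec N))
    {n v : Vec N} (hn : ‖n‖ = 1) (hv : v ≠ 0) {r : ℝ} (hr : 0 < r) (hr1 : r < 1 / 3)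
    (hv1 : ∑ j : Fin N, b.repr v j.succ ^ 2 ≤ r ^ 2 * ‖v‖ ^ 2)
    (hvn : |inner ℝ v n| ≤ r * ‖v‖) : b.repr n 0 ^ 2 ≤ 1 / 2 := by
  by_contra! hcon
  have hv0 : 0 < ‖v‖ := norm_pos_iff.2 hv
  have hnv := norm_sq_coords b v
  have hnn := norm_sq_coords b n
  rw [hn] at hnn
  have hin : inner ℝ v n =
      b.repr v 0 * b.repr n 0 + ∑ j : Fin N, b.repr v j.succ * b.repr n j.succ := by
    rw [← b.repr.inner_map_map, PiLp.inner_apply, Fin.sum_univ_succ]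
    simp [mul_comm]
  have hcs := Finset.sum_mul_sq_le_sq_mul_sq Finset.univ (fun j : Fin N => b.repr v j.succ)
    (fun j : Fin N => b.repr n j.succ)
  set S := ∑ j : Fin N, b.repr v j.succ * b.repr n j.succ
  set Sv := ∑ j : Fin N, b.repr v j.succ ^ 2
  set Sn := ∑ j : Fin N, b.repr n j.succ ^ 2
  have hSv0 : 0 ≤ Sv := Finset.sum_nonneg fun _ _ => sq_nonneg _
  have hSn1 : Sn ≤ 1 := by nlinarith [sq_nonneg (b.repr n 0)]
  have hS2 : S ^ 2 ≤ (r * ‖v‖) ^ 2 := by nlinarith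
  have hS : |S| ≤ r * ‖v‖ := abs_le_of_sq_le_sq hS2 (by positivity)
  have hprod : |b.repr v 0 * b.repr n 0| ≤ 2 * r * ‖v‖ := by
    have : b.repr v 0 * b.repr n 0 = inner ℝ v n - S := by rw [hin]; ring
    rw [this]
    refine (abs_sub _ _).trans ?_
    linarith
  have hsq : (b.repr v 0 * b.repr n 0) ^ 2 ≤ (2 * r * ‖v‖) ^ 2 :=
    sq_le_sq' (by linarith [(abs_le.1 hprod).1]) (abs_le.1 hprod).2
  have hr2 : r ^ 2 < 1 / 9 := by nlinarith
  have hv2 : 0 < ‖v‖ ^ 2 := by positivity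
  nlinarith [mul_lt_mul_of_pos_right hr2 hv2, sq_nonneg (b.repr v 0)]

theorem isProjAbsDecaying_projMeasure {N : ℕ} (hN : 0 < N) :
    IsProjAbsDecaying (projMeasure N) Set.univ := by
  have hNr : (1 : ℝ) ≤ N := by exact_mod_cast hN
  obtain ⟨V, hV, hVeq⟩ := volume_closedBall_eq_ofReal N
  set c : ℝ := 2 * N * (4 * 2 ^ (N - 1)) * (4 * (N + 1) ^ N) with hc
  have hc1 : 1 ≤ c := by
    have h1 : (1 : ℝ) ≤ 2 ^ (N - 1) := one_le_pow₀ (by norm_num)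
    have h2 : (1 : ℝ) ≤ (N + 1) ^ N := one_le_pow₀ (by linarith)
    refine one_le_mul_of_one_le_of_one_le (one_le_mul_of_one_le_of_one_le ?_ ?_) ?_ <;> linarith
  refine ⟨c, 1, 1 / 3, by linarith, one_pos, by norm_num, fun P hP ε hε p _ r hr hr1 => ?_⟩
  rw [Real.rpow_one]
  -- As `c ≥ 1`, the bound is trivial for `ε ≥ r`.
  rcases le_or_gt r ε with hrε | hεr
  · have h1 : 1 ≤ c * (ε / r) := one_le_mul_of_one_le_of_one_le hc1 ((one_le_div hr).2 hrε)
    calc _ ≤ projMeasure N (Metric.closedBall p r) := measure_mono Set.inter_subset_left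
      _ = ENNReal.ofReal 1 * projMeasure N (Metric.closedBall p r) := by simp
      _ ≤ _ := by gcongr
  obtain ⟨n, hn, hnP⟩ := hP.exists_unit_normal
  refine le_trans ?_ (mul_le_mul_right (ofReal_le_projMeasure_closedBall p hr (by linarith)) _)
  have hmeas : MeasurableSet (Metric.closedBall p r ∩ Metric.thickening ε P) :=
    Metric.isClosed_closedBall.measurableSet.inter Metric.isOpen_thickening.measurableSet
  obtain ⟨x, hx0, hx, rfl⟩ := exists_unit_rep p
  obtain ⟨b, rfl⟩ := exists_orthonormalBasis_zero_eq hx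
  by_cases hn0 : b.repr n 0 ^ 2 ≤ 1 / 2
  · -- The largest transversal coordinate of the normal is at least `1 / (2N)`.
    have : Nonempty (Fin N) := ⟨⟨0, hN⟩⟩
    obtain ⟨i, hi⟩ := Finite.exists_max fun i : Fin N => b.repr n i.succ ^ 2
    have hnn := norm_sq_coords b n
    rw [hn] at hnn
    have hsum : ∑ j : Fin N, b.repr n j.succ ^ 2 ≤ N * b.repr n i.succ ^ 2 :=
      (Finset.sum_le_card_nsmul _ _ _ fun j _ => hi j).trans (by simp)
    have hsing := Finset.single_le_sum (f := fun j : Fin N => b.repr n j.succ ^ 2)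
      (fun _ _ => sq_nonneg _) (Finset.mem_univ i)
    have habs1 : |b.repr n i.succ| ≤ 1 :=
      abs_le_of_sq_le_sq (by nlinarith [sq_nonneg (b.repr n 0)]) zero_le_one
    have hlow : 1 ≤ 2 * N * |b.repr n i.succ| := by
      have h1 : b.repr n i.succ ^ 2 ≤ |b.repr n i.succ| := by
        rw [← sq_abs]
        nlinarith [abs_nonneg (b.repr n i.succ)]
      nlinarith
    have hpos : 0 < |b.repr n i.succ| := by
      by_contra! h
      nlinarith
    have hinv : |b.repr n i.succ|⁻¹ ≤ 2 * N := by
      rw [inv_le_iff_one_le_mul₀ hpos]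
      exact hlow
    refine (projMeasure_le b hmeas (T := {w : Fin (N + 1) → ℝ | |w 0| ≤ 1 ∧
      (∀ j : Fin N, |w j.succ| ≤ r) ∧ |∑ j, b.repr n j * w j| ≤ ε}) ?_ ?_).trans
      ((ENNReal.div_le_div_right
        (volume_slab_box_le (fun j => b.repr n j) (abs_pos.1 hpos) hr hε) _).trans ?_)
    · refine IsClosed.measurableSet ?_
      simp only [Set.ofPred_and, Set.ofPred_forall]
      refine (isClosed_le (by fun_prop) (by fun_prop)).inter ((isClosed_iInter fun j =>
        isClosed_le (by fun_prop) (by fun_prop)).inter (isClosed_le (by fun_prop) (by fun_prop)))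
    · intro v hv hv1 hvM
      obtain ⟨h0, hj⟩ := coords_of_mem_closedBall b hx0 hr hv hv1 hvM.1
      refine ⟨h0, hj, ?_⟩
      have h1 := abs_inner_le_of_mem_thickening hn hnP hv hvM.2
      rw [← b.repr.inner_map_map, PiLp.inner_apply] at h1
      refine le_trans ?_ (h1.trans (mul_le_of_le_one_right hε.le hv1))
      simp
    · rw [hVeq, ← ENNReal.ofReal_div_of_pos hV, ← ENNReal.ofReal_div_of_pos hV,
        ← ENNReal.ofReal_mul (by positivity), ← mul_div_assoc]
      refine ENNReal.ofReal_le_ofReal (div_le_div_of_nonneg_right ?_ hV.le)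
      calc |b.repr n i.succ|⁻¹ * (4 * ε * (2 * r) ^ (N - 1))
          ≤ 2 * N * (4 * ε * (2 * r) ^ (N - 1)) := by gcongr
        _ = c * (ε / r) * ((4 * ((N : ℝ) + 1) ^ N)⁻¹ * r ^ N) := by
          obtain ⟨M, rfl⟩ : ∃ M, N = M + 1 := ⟨N - 1, by omega⟩
          rw [hc, Nat.add_sub_cancel, mul_pow, pow_succ r M]
          field_simp
  · -- A hyperplane whose normal is close to the centre stays away from the ball.
    have hempty : Metric.closedBall (Projectivization.mk ℝ (b 0) hx0 : RealProj N) r ∩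
        Metric.thickening ε P = ∅ := by
      rw [Set.eq_empty_iff_forall_notMem]
      rintro q ⟨hq1, hq2⟩
      induction q using Projectivization.ind with
      | h v hv =>
        rw [Metric.mem_closedBall, dist_mk_le_iff b hv hx0 hr.le] at hq1
        refine hn0 (sq_inner_zero_le_half b hn hv hr hr1 hq1
          ((abs_inner_le_of_mem_thickening hn hnP hv hq2).trans ?_))
        gcongr
    rw [hempty, measure_empty]
    exact zero_le

end ProjBad

theorem mainTheorem2 (N : ℕ) (hN : 1 ≤ N) :
    dimH (ProjBad.Bad N) = (N : ENNReal) ∧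
      ProjBad.IsAhlforsRegular (ProjBad.projMeasure N) Set.univ (N : ℝ) ∧
      ProjBad.IsProjAbsDecaying (ProjBad.projMeasure N) Set.univ :=
  ⟨ProjBad.dimH_Bad hN, ProjBad.isAhlforsRegular_projMeasure hN,
    ProjBad.isProjAbsDecaying_projMeasure hN⟩
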